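/- **Setting.** A ridesharing market consists of a horizon $T\in\mathbb N$, a finite set $\mathcal L$ of locations, travel times $\delta(a,b)\in\mathbb N$ with $\delta(a,b)\ge 1$ and $\delta(a,a)=1$, the set $\mathcal T=\{(a,b,t): a,b\in\mathcal L,\ t\in\mathbb N,\ t+\delta(a,b)\le T\}$ of feasible trips, trip costs $c_{a,b,t}\ge 0$, and costs $\kappa_\Delta\ge 0$ (with $\kappa_0=0$) of exiting $\Delta$ periods before time $T$. There is a finite set $\mathcal D$ of drivers; driver $i$ has type $\theta_i=(s_i,r_i,\tau_i,\bar\tau_i)$, where $s_i\in\{0,1\}$ says whether she has already entered the platform, she is available from location $r_i$ at time $\tau_i\le T$, and she intends to leave at a time $\bar\tau_i>\tau_i$ with $\bar\tau_i\ge T$. There is a finite set $\mathcal R$ of riders; rider $j$ requests one trip $e_j=(o_j,d_j,t_j)\in\mathcal T$, for which she has value $v_j\ge 0$. A feasible path of driver $i$ is a finite, possibly empty sequence of trips in $\mathcal T$, the first starting at $r_i$ at time $\tau_i$ and each later one starting where and when the previous one ends. Let $\mathcal Z_i$ be the (finite) set of these paths. The cost $\lambda_i(Z)$ of $Z\in\mathcal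 Z_i$ is the sum of its trip costs plus $\kappa_{T-t'}$, where $t'$ is the time at which $Z$ ends ($t'=\tau_i$ if $Z$ is empty), except that the empty path costs $0$ if $s_i=0$ (the driver does not enter). A feasible action path of driver $i$ is a path in $\mathcal Z_i$ together with, for each of its trips, either no rider or one rider who requests exactly that trip; its cost is that of the underlying path. A plan with anonymous trip prices $(x,\tilde z,p)$ consists of $x\in\{0,1\}^{\mathcal R}$, a feasible action path $\tilde z_i$ for each driver $i$, and prices $p\in\mathbb R^{\mathcal T}$, such that for every rider $j$ the number of drivers $i$ with rider $j$ on $\tilde z_i$ equals $x_j$. The utility of driver $i$ is $\pi_i=\sum_{j\text{ on }\tilde z_i}p_{e_j}$ minus the cost of $\tilde z_i$. The plan is a competitive equilibrium (CE) if (i) for every rider $j$, $v_j>p_{e_j}$ implies $x_j=1$, and $x_j=1$ implies $v_j\ge p_{e_j}$; and (ii) for every driver $i$, $\pi_i=\max_{Z\in\mathcal Z_i}\bigl\{\sum_{e\in Z}\max\{p_e,0\}-\lambda_i(Z)\bigr\}$. Let $W(\mathcal D,\mathcal R)$ be the highest achievable welfare, i.e. the maximum of $\sum_{j}x_jv_j-\sum_i\sum_{Z\in\mathcal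 Z_i}y_{i,Z}\lambda_i(Z)$ over all real $x_j\in[0,1]$ and $y_{i,Z}\ge 0$ with $\sum_{Z\in\mathcal Z_i}y_{i,Z}=1$ for every driver $i$ and $\sum_{j:\,e_j=e}x_j\le\sum_i\sum_{Z\in\mathcal Z_i:\,e\in Z}y_{i,Z}$ for every $e\in\mathcal T$. For a driver $i$ put $$\Phi_i=W(\mathcal D\cup\{i'\},\mathcal R)-W(\mathcal D,\mathcal R),\qquad \Psi_i=W(\mathcal D,\mathcal R)-W(\mathcal D\setminus\{i\},\mathcal R),$$ where $i'$ is an additional driver with $\theta_{i'}=\theta_i$. **Lemma 4 (Lattice structure).** Let $U\subseteq\mathbb R^{\mathcal D}$ be the set of driver utility profiles $\pi=(\pi_i)_{i\in\mathcal D}$ of all CE plans. Then $U$ is a lattice under the componentwise order: if $\pi,\pi'\in U$, then the profiles $(\max\{\pi_i,\pi'_i\})_i$ and $(\min\{\pi_i,\pi'_i\})_i$ belong to $U$. Moreover $U$ has a least element (the profile of the driver-pessimal CE plans), equal to $(\Phi_i)_{i\in\mathcal D}$, and a greatest element (the profile of the driver-optimal CE plans), equal to $(\Psi_i)_{i\in\mathcal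 D}$. -/

import Mathlib

/-- The primitives of a ridesharing market over a set `L` of locations: horizon `T`, travel times
`dist`, trip costs `cost a b t` and early-exit costs `exitCost Δ` (exiting `Δ` periods before `T`).
Only the values of `cost` at trips that end by time `T` are ever used. -/
structure Market (L : Type*) where
  T : ℕ
  dist : L → L → ℕ
  one_le_dist : ∀ a b, 1 ≤ dist a b
  dist_self : ∀ a, dist a a = 1
  cost : L → L → ℕ → ℝ
  cost_nonneg : ∀ a b t, 0 ≤ cost a b t
  exitCost : ℕ → ℝ
  exitCost_nonneg : ∀ Δ, 0 ≤ exitCost Δ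
  exitCost_zero : exitCost 0 = 0

namespace Market

variable {L : Type*}

/-- A trip `(orig, dest, start)` that ends within the planning horizon. -/
@[ext]
structure Trip (M : Market L) where
  orig : L
  dest : L
  start : ℕ
  end_le : start + M.dist orig dest ≤ M.T

/-- The time at which a trip ends. -/
def Trip.finish {M : Market L} (e : M.Trip) : ℕ := e.start + M.dist e.orig e.dest

/-- The cost of a trip to the driver. -/
def Trip.tripCost {M : Market L} (e : M.Trip) : ℝ := M.cost e.orig e.dest e.start

/-- A driver type: whether the driver has already entered the platform, the location and time of
(possible) entrance, and the intended exit time, which is not before the end of the horizon. -/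
structure DriverType (M : Market L) where
  entered : Bool
  loc : L
  entry : ℕ
  exit : ℕ
  entry_le : entry ≤ M.T
  entry_lt_exit : entry < exit
  horizon_le_exit : M.T ≤ exit

/-- A rider type: the requested trip (within the horizon) and the value for it. -/
structure RiderType (M : Market L) where
  trip : M.Trip
  value : ℝ
  value_nonneg : 0 ≤ value

/-- `M.IsRoute a t l`: the trips in `l` are consecutive, the first one starting at `(a, t)`. -/
def IsRoute (M : Market L) : L → ℕ → List M.Trip → Prop
  | _, _, [] => True
  | a, t, e :: l => e.orig = a ∧ e.start = t ∧ M.IsRoute e.dest e.finish l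

/-- The time at which a route that starts at time `t` ends. -/
def routeEnd (M : Market L) : ℕ → List M.Trip → ℕ
  | t, [] => t
  | _, e :: l => M.routeEnd e.finish l

/-- The feasible paths of a driver. The empty path stands for not entering the platform, or, for a
driver who has already entered, for exiting immediately. -/
def FeasiblePath (M : Market L) (d : M.DriverType) : Type _ :=
  {l : List M.Trip // M.IsRoute d.loc d.entry l}

open Classical in
/-- The cost of a sequence of trips to a driver: the trip costs plus the cost of exiting early;
not entering the platform costs nothing. -/
noncomputable def pathCost (M : Market L) (d : M.DriverType) (l : List M.Trip) : ℝ :=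
  if d.entered = false ∧ l = [] then 0
  else (l.map Trip.tripCost).sum + M.exitCost (M.T - M.routeEnd d.entry l)

theorem IsRoute.start_ge {M : Market L} {a : L} {t : ℕ} {l : List M.Trip}
    (h : M.IsRoute a t l) : ∀ e ∈ l, t ≤ e.start := by
  induction l generalizing a t with
  | nil => simp
  | cons e l ih =>
    obtain ⟨-, h2, h3⟩ := h
    intro f hf
    rcases List.mem_cons.1 hf with rfl | hf
    · exact h2.ge
    · have := ih h3 f hf
      unfold Trip.finish at this
      omega

theorem IsRoute.nodup {M : Market L} {a : L} {t : ℕ} {l : List M.Trip}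
    (h : M.IsRoute a t l) : l.Nodup := by
  induction l generalizing a t with
  | nil => simp
  | cons e l ih =>
    obtain ⟨-, h2, h3⟩ := h
    refine List.nodup_cons.2 ⟨fun he => ?_, ih h3⟩
    have h4 := h3.start_ge e he
    have h5 := M.one_le_dist e.orig e.dest
    unfold Trip.finish at h4
    omega

instance instFiniteTrip [Finite L] (M : Market L) : Finite M.Trip :=
  Finite.of_injective
    (fun e : M.Trip => ((e.orig, e.dest, ⟨e.start, by have := e.end_le; omega⟩) :
      L × L × Fin (M.T + 1)))
    (fun e f h => by
      simp only [Prod.mk.injEq, Fin.mk.injEq] at h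
      exact Trip.ext h.1 h.2.1 h.2.2)

instance instFiniteFeasiblePath [Finite L] (M : Market L) (d : M.DriverType) :
    Finite (M.FeasiblePath d) := by
  classical
  have := Fintype.ofFinite M.Trip
  exact Finite.of_injective
    (fun k : M.FeasiblePath d => (⟨k.1, k.2.nodup⟩ : {l : List M.Trip // l.Nodup}))
    (fun k k' h => Subtype.ext (congrArg (fun x => x.1) h))

noncomputable instance instFintypeFeasiblePath [Finite L] (M : Market L) (d : M.DriverType) :
    Fintype (M.FeasiblePath d) := Fintype.ofFinite _

/-- A feasible action path of a driver: a feasible path, each trip of which is either a relocation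
trip (`none`) or carries a rider `j` who requests this very trip (`some j`). -/
structure ActionPath (M : Market L) {R : Type*} (ρ : R → M.RiderType) (d : M.DriverType) where
  steps : List (M.Trip × Option R)
  isRoute : M.IsRoute d.loc d.entry (steps.map Prod.fst)
  rider_trip : ∀ e j, (e, some j) ∈ steps → e = (ρ j).trip

/-- The driver who follows the action path `z` carries rider `j`. -/
def ActionPath.Serves {M : Market L} {R : Type*} {ρ : R → M.RiderType} {d : M.DriverType}
    (z : M.ActionPath ρ d) (j : R) : Prop :=
  ((ρ j).trip, some j) ∈ z.steps

/-- The cost of an action path, that is, of the path with the same movement in space and time. -/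
noncomputable def ActionPath.actionCost {M : Market L} {R : Type*} {ρ : R → M.RiderType}
    {d : M.DriverType} (z : M.ActionPath ρ d) : ℝ :=
  M.pathCost d (z.steps.map Prod.fst)

/-- A plan with anonymous trip prices: the rider pick-ups `x`, the action paths `z` of the drivers
and the trip prices `price`. -/
structure Plan (M : Market L) {D R : Type*} (θ : D → M.DriverType) (ρ : R → M.RiderType) where
  x : R → ℕ
  z : ∀ i, M.ActionPath ρ (θ i)
  price : M.Trip → ℝ

section Plan

variable {M : Market L} {D R : Type*} {θ : D → M.DriverType} {ρ : R → M.RiderType}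

open Classical in
/-- A rider is picked up exactly if she is on the action path of a driver, and by at most one
driver. -/
def Plan.Feasible [Fintype D] (P : M.Plan θ ρ) : Prop :=
  ∀ j, P.x j = (∑ i, if (P.z i).Serves j then 1 else 0) ∧ P.x j ∈ ({0, 1} : Set ℕ)

open Classical in
/-- The total payment to driver `i`: the prices of the trips on which she carries a rider. -/
noncomputable def Plan.driverPayment [Fintype R] (P : M.Plan θ ρ) (i : D) : ℝ :=
  ∑ j, if (P.z i).Serves j then P.price (ρ j).trip else 0

/-- The utility of driver `i`: her total payment minus her total cost. -/
noncomputable def Plan.utility [Fintype R] (P : M.Plan θ ρ) (i : D) : ℝ :=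
  P.driverPayment i - (P.z i).actionCost

/-- A feasible plan is a competitive equilibrium if riders and drivers best respond to prices. -/
structure Plan.IsCE [Fintype D] [Fintype R] (P : M.Plan θ ρ) : Prop where
  feasible : P.Feasible
  picked_up : ∀ j, P.price (ρ j).trip < (ρ j).value → P.x j = 1
  affordable : ∀ j, P.x j = 1 → P.price (ρ j).trip ≤ (ρ j).value
  driver_best_response : ∀ i, IsGreatest
    (Set.range fun k : M.FeasiblePath (θ i) =>
      (k.1.map fun e => max (P.price e) 0).sum - M.pathCost (θ i) k.1)
    (P.utility i)

end Plan

/-- The set of driver utility profiles of all competitive equilibrium plans. -/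
def ceUtilities (M : Market L) {D R : Type*} [Fintype D] [Fintype R] (θ : D → M.DriverType)
    (ρ : R → M.RiderType) : Set (D → ℝ) :=
  {π | ∃ P : M.Plan θ ρ, P.IsCE ∧ ∀ i, π i = P.utility i}

open Classical in
/-- The constraints of the planning linear program: `x j` is the extent to which rider `j` is
picked up, and `y i k` the extent to which driver `i` takes her feasible path `k`. -/
structure LPFeasible [Finite L] (M : Market L) {D R : Type*} [Fintype D] [Fintype R]
    (θ : D → M.DriverType) (ρ : R → M.RiderType)
    (x : R → ℝ) (y : ∀ i, M.FeasiblePath (θ i) → ℝ) : Prop where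
  capacity : ∀ e : M.Trip, (∑ j, if (ρ j).trip = e then x j else 0) ≤
    ∑ i, ∑ k : M.FeasiblePath (θ i), if e ∈ k.1 then y i k else 0
  one_path : ∀ i, ∑ k : M.FeasiblePath (θ i), y i k = 1
  x_le_one : ∀ j, x j ≤ 1
  x_nonneg : ∀ j, 0 ≤ x j
  y_nonneg : ∀ i k, 0 ≤ y i k

/-- The highest achievable welfare: the optimal objective value of the planning linear program. -/
noncomputable def socialWelfare [Finite L] (M : Market L) {D R : Type*} [Fintype D] [Fintype R]
    (θ : D → M.DriverType) (ρ : R → M.RiderType) : ℝ :=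
  sSup {w | ∃ x y, M.LPFeasible θ ρ x y ∧
    w = ∑ j, x j * (ρ j).value - ∑ i, ∑ k, y i k * M.pathCost (θ i) k.1}

/-- The welfare gain from replicating driver `i`; the drivers are then `Option D`, where `none` is
the replica. -/
noncomputable def replicaGain [Finite L] (M : Market L) {D R : Type*} [Fintype D] [Fintype R]
    (θ : D → M.DriverType) (ρ : R → M.RiderType) (i : D) : ℝ :=
  M.socialWelfare (fun o : Option D => o.elim (θ i) θ) ρ - M.socialWelfare θ ρ

/-- The welfare loss from removing driver `i`. -/
noncomputable def removalLoss [Finite L] (M : Market L) {D R : Type*} [Fintype D] [DecidableEq D]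
    [Fintype R] (θ : D → M.DriverType) (ρ : R → M.RiderType) (i : D) : ℝ :=
  M.socialWelfare θ ρ - M.socialWelfare (fun i' : {i' : D // i' ≠ i} => θ i') ρ

end Market

/-! The planning program is a minimum-cost flow problem on a time-expanded acyclic network. Each
driver supplies one unit at her entry node, and all flow ends in one sink. Relocation, exiting,
entering and staying out are edges of unbounded capacity. Each rider adds a capacity-one edge
parallel to her trip, with her value subtracted from its cost. Dual solutions are potentials `φ`
(continuation values), and they price trips by `tripPrice φ`.

The key fact, `mem_ceUtilities_iff`, is that CE utility profiles are exactly the values of optimal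
potentials at the driver nodes. From a CE, the best-payoff function at the prices `max p 0` is a
potential, and its dual value is at most the total utility of the CE, hence at most the welfare
(`Plan.IsCE.exists_potential`). Conversely, successive shortest paths give an integral optimal flow.
It satisfies complementary slackness with every optimal potential, and its path decomposition is a
CE plan (`exists_isCE_of_compat`).

The lattice property follows because potentials are closed under pointwise max and min, and the dual
objective is submodular. For the extremes, adding a copy of driver `i` raises the dual objective at
`φ` by `φ` at her node. Weak duality then bounds her utility below by `replicaGain`, and removing
her bounds it above by `removalLoss`. One augmentation step yields a potential that is optimal both
before and after a driver is added (`exists_common_potential`), so each bound is attained one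
coordinate at a time. The lattice operations then attain all coordinates at once. -/

/-! ### Minimum-cost flows: complementary slackness and augmentation -/

/-- A network with a sink, real edge costs, and two kinds of edges: those of capacity one (`unit`)
and those of unbounded capacity. -/
structure FlowNetwork (V E : Type*) where
  src : E → V
  tgt : E → V
  sink : V
  cost : E → ℝ
  unit : Set E

namespace FlowNetwork

variable {V E : Type*} (N : FlowNetwork V E)

/-- The reduced cost of an edge with respect to a potential. -/
def red (φ : V → ℝ) (e : E) : ℝ := N.cost e + φ (N.src e) - φ (N.tgt e)

/-- The net supply of a flow, as a linear functional on functions of the nodes. -/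
noncomputable def net [Fintype E] (f : E → ℕ) (g : V → ℝ) : ℝ :=
  ∑ e, (f e : ℝ) * (g (N.src e) - g (N.tgt e))

/-- A flow respects the capacities and satisfies complementary slackness with a potential. -/
structure Compat (f : E → ℕ) (φ : V → ℝ) : Prop where
  cap : ∀ e ∈ N.unit, f e ≤ 1
  red_nonpos : ∀ e, 0 < f e → N.red φ e ≤ 0
  red_nonneg : ∀ e, (e ∈ N.unit → f e = 0) → 0 ≤ N.red φ e

/-- There is a residual arc of reduced cost zero from `v` to `w`. -/
def TightArc (f : E → ℕ) (φ : V → ℝ) (v w : V) : Prop :=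
  ∃ e, N.red φ e = 0 ∧ ((N.src e = v ∧ N.tgt e = w ∧ (e ∈ N.unit → f e = 0)) ∨
    (N.tgt e = v ∧ N.src e = w ∧ 0 < f e))

/-- `l` is the list of nodes of a tight residual path that ends in the sink. -/
def IsTightPath (f : E → ℕ) (φ : V → ℝ) : V → List V → Prop
  | v, [] => v = N.sink
  | v, u :: l => N.TightArc f φ v u ∧ IsTightPath f φ u l

variable {N}

theorem IsTightPath.exists_of_mem {f : E → ℕ} {φ : V → ℝ} {v : V} {l : List V}
    (h : N.IsTightPath f φ v l) (hl : (v :: l).Nodup) {u : V} (hu : u ∈ v :: l) :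
    ∃ l', (u :: l').Nodup ∧ N.IsTightPath f φ u l' := by
  induction l generalizing v with
  | nil =>
    obtain rfl : u = v := by simpa using hu
    exact ⟨[], by simp, h⟩
  | cons a l ih =>
    rcases List.mem_cons.1 hu with rfl | hu
    · exact ⟨_, hl, h⟩
    · exact ih h.2 (List.nodup_cons.1 hl).2 hu

/-- Loops are cut off whenever a new node already lies on the path. Simplicity ensures that
augmentation changes each edge at most once. -/
theorem exists_isTightPath {f : E → ℕ} {φ : V → ℝ} {v : V}
    (h : Relation.ReflTransGen (N.TightArc f φ) v N.sink) :
    ∃ l, (v :: l).Nodup ∧ N.IsTightPath f φ v l := by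
  induction h using Relation.ReflTransGen.head_induction_on with
  | refl => exact ⟨[], by simp, rfl⟩
  | @head a b h1 _ ih =>
    obtain ⟨l, hl, hp⟩ := ih
    by_cases ha : a ∈ b :: l
    · exact hp.exists_of_mem hl ha
    · exact ⟨b :: l, List.nodup_cons.2 ⟨ha, hl⟩, h1, hp⟩

/-- Complementary slackness puts no condition on the flow through an edge of reduced cost zero, so
only the capacity matters. -/
theorem Compat.update [DecidableEq E] {f : E → ℕ} {φ : V → ℝ} (h : N.Compat f φ) {e : E}
    (he : N.red φ e = 0) {m : ℕ} (hm : e ∈ N.unit → m ≤ 1) :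
    N.Compat (Function.update f e m) φ where
  cap e' h' := by
    by_cases hee : e' = e
    · subst hee; simpa using hm h'
    · simpa [hee] using h.cap e' h'
  red_nonpos e' h' := by
    by_cases hee : e' = e
    · subst hee; exact he.le
    · exact h.red_nonpos e' (by simpa [hee] using h')
  red_nonneg e' h' := by
    by_cases hee : e' = e
    · subst hee; exact he.ge
    · exact h.red_nonneg e' (by simpa [hee] using h')

theorem net_update [Fintype E] [DecidableEq E] (f : E → ℕ) (e : E) (m : ℕ) (g : V → ℝ) :
    N.net (Function.update f e m) g
      = N.net f g + ((m : ℝ) - f e) * (g (N.src e) - g (N.tgt e)) := by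
  unfold net
  rw [← Finset.add_sum_erase _ _ (Finset.mem_univ e),
    ← Finset.add_sum_erase (a := e) Finset.univ
      (fun e => (f e : ℝ) * (g (N.src e) - g (N.tgt e))) (Finset.mem_univ e)]
  have : ∑ x ∈ Finset.univ.erase e, ((Function.update f e m x : ℕ) : ℝ)
        * (g (N.src x) - g (N.tgt x))
      = ∑ x ∈ Finset.univ.erase e, (f x : ℝ) * (g (N.src x) - g (N.tgt x)) :=
    Finset.sum_congr rfl fun x hx => by
      rw [Function.update_of_ne (Finset.ne_of_mem_erase hx)]
  rw [this]
  simp only [Function.update_self]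
  ring

/-- One unit of flow can be pushed along a simple tight residual path. -/
theorem Compat.augment [Fintype E] {f : E → ℕ} {φ : V → ℝ} (h : N.Compat f φ) {v : V}
    {l : List V} (hl : (v :: l).Nodup) (hp : N.IsTightPath f φ v l) :
    ∃ f', N.Compat f' φ ∧ (∀ g, N.net f' g = N.net f g + g v - g N.sink) ∧
      ∀ e, (N.src e ∉ v :: l ∨ N.tgt e ∉ v :: l) → f' e = f e := by
  classical
  induction l generalizing v with
  | nil =>
    obtain rfl : v = N.sink := hp
    exact ⟨f, h, by simp, by simp⟩
  | cons u l ih =>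
    obtain ⟨hv, hl'⟩ := List.nodup_cons.1 hl
    obtain ⟨⟨e, he, harc⟩, hp'⟩ := hp
    obtain ⟨f', hc, hn, hf⟩ := ih hl' hp'
    -- The edge `e` meets `v`, which is not on the rest of the path, so the earlier augmentation
    -- left it alone.
    have hfe : f' e = f e := hf e (by
      rcases harc with ⟨h1, -⟩ | ⟨h1, -⟩
      · exact Or.inl (h1 ▸ hv)
      · exact Or.inr (h1 ▸ hv))
    have hne : ∀ m e', (N.src e' ∉ v :: u :: l ∨ N.tgt e' ∉ v :: u :: l) →
        Function.update f' e m e' = f e' := by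
      intro m e' he'
      have hee : e' ≠ e := by
        rintro rfl
        rcases harc with ⟨h1, h2, -⟩ | ⟨h1, h2, -⟩ <;> simp [h1, h2] at he'
      rw [Function.update_of_ne hee]
      refine hf e' (he'.imp ?_ ?_) <;> exact fun h3 h4 => h3 (List.mem_cons_of_mem _ h4)
    rcases harc with ⟨h1, h2, h3⟩ | ⟨h1, h2, h3⟩
    · refine ⟨Function.update f' e (f e + 1), hc.update he fun hu => by simp [h3 hu],
        fun g => ?_, hne _⟩
      rw [net_update, hn, hfe, h1, h2]
      push_cast
      ring
    · refine ⟨Function.update f' e (f e - 1), hc.update he fun hu => ?_, fun g => ?_, hne _⟩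
      · have := h.cap e hu
        omega
      · rw [net_update, hn, hfe, h1, h2, Nat.cast_sub h3]
        push_cast
        ring

open Classical in
/-- Lowering the potential on the nodes from which the sink is not tightly reachable, until a new
residual arc becomes tight. -/
theorem Compat.exists_reachable_ssubset [Fintype V] [Fintype E] {f : E → ℕ} {φ : V → ℝ}
    (h : N.Compat f φ) {r : V} (hr : ∃ e, N.src e = r ∧ N.tgt e = N.sink ∧ e ∉ N.unit)
    (hnr : ¬ Relation.ReflTransGen (N.TightArc f φ) r N.sink) :
    ∃ φ', N.Compat f φ' ∧ φ' N.sink = φ N.sink ∧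
      (Finset.univ.filter fun v => ¬ Relation.ReflTransGen (N.TightArc f φ') v N.sink) ⊂
      Finset.univ.filter fun v => ¬ Relation.ReflTransGen (N.TightArc f φ) v N.sink := by
  set S : Set V := {v | Relation.ReflTransGen (N.TightArc f φ) v N.sink} with hS
  have hsink : N.sink ∈ S := Relation.ReflTransGen.refl
  have hclosed : ∀ {v w}, N.TightArc f φ v w → w ∈ S → v ∈ S := fun hvw hw =>
    Relation.ReflTransGen.head hvw hw
  -- `A` consists of the residual arcs that enter `S` from outside. Lowering `φ` off `S` by the
  -- least absolute reduced cost in `A` makes one of them tight and violates none.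
  let A : Finset E := Finset.univ.filter fun e =>
    (N.src e ∉ S ∧ N.tgt e ∈ S ∧ (e ∈ N.unit → f e = 0)) ∨
      (N.tgt e ∉ S ∧ N.src e ∈ S ∧ 0 < f e)
  have hA : A.Nonempty := by
    obtain ⟨e, h1, h2, h3⟩ := hr
    refine ⟨e, Finset.mem_filter.2 ⟨Finset.mem_univ _, Or.inl ⟨?_, ?_, fun h => (h3 h).elim⟩⟩⟩
    · rw [h1]; exact hnr
    · rw [h2]; exact hsink
  obtain ⟨e₀, he₀, hmin⟩ := A.exists_min_image (fun e => |N.red φ e|) hA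
  set ε := |N.red φ e₀| with hε
  have hε0 : 0 ≤ ε := abs_nonneg _
  let φ' : V → ℝ := fun v => if v ∈ S then φ v else φ v - ε
  have hin : ∀ {v}, v ∈ S → φ' v = φ v := fun hv => if_pos hv
  have hout : ∀ {v}, v ∉ S → φ' v = φ v - ε := fun hv => if_neg hv
  have hfwd : ∀ e, N.src e ∉ S → N.tgt e ∈ S → N.red φ' e = N.red φ e - ε := by
    intro e h1 h2; simp only [red, hin h2, hout h1]; ring
  have hbwd : ∀ e, N.src e ∈ S → N.tgt e ∉ S → N.red φ' e = N.red φ e + ε := by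
    intro e h1 h2; simp only [red, hin h1, hout h2]; ring
  have hsame : ∀ e, (N.src e ∈ S ↔ N.tgt e ∈ S) → N.red φ' e = N.red φ e := by
    intro e h1
    by_cases h2 : N.src e ∈ S
    · simp only [red, hin h2, hin (h1.1 h2)]
    · simp only [red, hout h2, hout (mt h1.2 h2)]; ring
  have hc : N.Compat f φ' := by
    refine ⟨h.cap, fun e he => ?_, fun e he => ?_⟩
    · have h0 := h.red_nonpos e he
      by_cases h1 : N.src e ∈ S <;> by_cases h2 : N.tgt e ∈ S
      · rw [hsame e (by tauto)]; exact h0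
      · have := hmin e (Finset.mem_filter.2 ⟨Finset.mem_univ _, Or.inr ⟨h2, h1, he⟩⟩)
        rw [abs_of_nonpos h0] at this
        rw [hbwd e h1 h2]; linarith
      · rw [hfwd e h1 h2]; linarith
      · rw [hsame e (by tauto)]; exact h0
    · have h0 := h.red_nonneg e he
      by_cases h1 : N.src e ∈ S <;> by_cases h2 : N.tgt e ∈ S
      · rw [hsame e (by tauto)]; exact h0
      · rw [hbwd e h1 h2]; linarith
      · have := hmin e (Finset.mem_filter.2 ⟨Finset.mem_univ _, Or.inl ⟨h1, h2, he⟩⟩)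
        rw [abs_of_nonneg h0] at this
        rw [hfwd e h1 h2]; linarith
      · rw [hsame e (by tauto)]; exact h0
  -- Arcs within `S` keep their reduced cost, so old tight paths survive.
  have hmono : ∀ v ∈ S, Relation.ReflTransGen (N.TightArc f φ') v N.sink := by
    intro v hv
    induction hv using Relation.ReflTransGen.head_induction_on with
    | refl => exact Relation.ReflTransGen.refl
    | head h1 h2 ih =>
      refine Relation.ReflTransGen.head ?_ ih
      have h3 := hclosed h1 h2
      obtain ⟨e, he, harc⟩ := h1
      refine ⟨e, ?_, harc⟩
      rw [← he]
      refine hsame e ?_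
      rcases harc with ⟨rfl, rfl, -⟩ | ⟨rfl, rfl, -⟩
      · exact iff_of_true h3 h2
      · exact iff_of_true h2 h3
  refine ⟨φ', hc, hin hsink, Finset.ssubset_iff_subset_ne.2 ⟨?_, ?_⟩⟩
  · intro v hv
    simp only [Finset.mem_filter, Finset.mem_univ, true_and] at hv ⊢
    exact fun h' => hv (hmono v h')
  · intro heq
    have key : ∀ v, v ∉ S → ¬ Relation.ReflTransGen (N.TightArc f φ') v N.sink := by
      intro v hv
      have : v ∈ Finset.univ.filter fun v => ¬ Relation.ReflTransGen (N.TightArc f φ) v N.sink :=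
        Finset.mem_filter.2 ⟨Finset.mem_univ _, hv⟩
      rw [← heq] at this
      exact (Finset.mem_filter.1 this).2
    -- The minimizing arc `e₀` is now tight, so its endpoint outside `S` reaches the sink.
    rcases (Finset.mem_filter.1 he₀).2 with ⟨h1, h2, h3⟩ | ⟨h1, h2, h3⟩
    · refine key _ h1 (Relation.ReflTransGen.head ⟨e₀, ?_, Or.inl ⟨rfl, rfl, h3⟩⟩ (hmono _ h2))
      rw [hfwd e₀ h1 h2, hε, abs_of_nonneg (h.red_nonneg _ h3), sub_self]
    · refine key _ h1 (Relation.ReflTransGen.head ⟨e₀, ?_, Or.inr ⟨rfl, rfl, h3⟩⟩ (hmono _ h2))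
      rw [hbwd e₀ h2 h1, hε, abs_of_nonpos (h.red_nonpos _ h3), add_neg_cancel]

/-- Successive shortest paths: some potential is compatible both with the given flow and with a
flow that ships one more unit from `r` to the sink. -/
theorem Compat.exists_augmentation [Fintype V] [Fintype E] {f : E → ℕ} {φ : V → ℝ}
    (h : N.Compat f φ) {r : V} (hr : ∃ e, N.src e = r ∧ N.tgt e = N.sink ∧ e ∉ N.unit) :
    ∃ φ' f', N.Compat f φ' ∧ N.Compat f' φ' ∧ φ' N.sink = φ N.sink ∧
      ∀ g, N.net f' g = N.net f g + g r - g N.sink := by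
  classical
  -- The flow stays fixed while the potential is lowered. The set of nodes that cannot reach the
  -- sink shrinks strictly until `r` leaves it.
  induction hA : (Finset.univ.filter fun v => ¬ Relation.ReflTransGen (N.TightArc f φ) v N.sink)
    using Finset.strongInduction generalizing φ with
  | H A ih =>
    by_cases hreach : Relation.ReflTransGen (N.TightArc f φ) r N.sink
    · obtain ⟨l, hl, hp⟩ := exists_isTightPath hreach
      obtain ⟨f', h1, h2, -⟩ := h.augment hl hp
      exact ⟨φ, f', h, h1, rfl, h2⟩
    · obtain ⟨φ₁, h1, h2, h3⟩ := h.exists_reachable_ssubset hr hreach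
      obtain ⟨φ', f', h4, h5, h6, h7⟩ := ih _ (hA ▸ h3) h1 rfl
      exact ⟨φ', f', h4, h5, h6.trans h2, h7⟩

/-! ### Decomposition of flows into paths -/

variable (N) in
/-- A list of consecutive edges from a node to the sink. -/
def IsPath : V → List E → Prop
  | v, [] => v = N.sink
  | v, e :: p => N.src e = v ∧ IsPath (N.tgt e) p

/-- Following a unit of supply to the sink. -/
theorem exists_path_of_net [Fintype E] [DecidableEq E] {D : Type*} (n : D → V) (s : Finset D)
    {f : E → ℕ} {v : V}
    (h : ∀ g : V → ℝ, g N.sink = 0 → N.net f g = ∑ i ∈ s, g (n i) + g v) :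
    ∃ p f', N.IsPath v p ∧ (∀ e, f e = f' e + p.count e) ∧
      ∀ g : V → ℝ, g N.sink = 0 → N.net f' g = ∑ i ∈ s, g (n i) := by
  classical
  induction hk : ∑ e, f e using Nat.strong_induction_on generalizing f v with
  | _ k ih =>
    by_cases hv : v = N.sink
    · refine ⟨[], f, hv, by simp, fun g hg => ?_⟩
      rw [h g hg, hv, hg, add_zero]
    · obtain ⟨e, he, hfe⟩ : ∃ e, N.src e = v ∧ 0 < f e := by
        by_contra! hcon
        -- Test conservation against the indicator of `v`: if no flow left `v`, its net supply would
        -- be at most zero, but it is at least one.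
        have h1 := h (fun u => if u = v then 1 else 0) (if_neg (Ne.symm hv))
        have h2 : N.net f (fun u => if u = v then 1 else 0) ≤ 0 := by
          refine Finset.sum_nonpos fun e _ => ?_
          by_cases he : N.src e = v
          · have : f e = 0 := Nat.le_zero.1 (hcon e he)
            simp [this]
          · simp only [he, if_false, zero_sub, mul_neg, neg_nonpos]
            positivity
        have h3 : 0 ≤ ∑ i ∈ s, (if n i = v then (1 : ℝ) else 0) :=
          Finset.sum_nonneg fun i _ => by positivity
        rw [h1] at h2
        simp only [if_true] at h2
        linarith
      let f₁ := Function.update f e (f e - 1)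
      have hf₁ : ∀ e', f e' = f₁ e' + [e].count e' := by
        intro e'
        by_cases hee : e' = e
        · subst hee; simp [f₁]; omega
        · simp [f₁, hee, Ne.symm hee]
      have hlt : ∑ e, f₁ e < k := by
        rw [← hk]
        refine Finset.sum_lt_sum (fun e' _ => by rw [hf₁ e']; omega) ⟨e, Finset.mem_univ _, ?_⟩
        rw [hf₁ e]; simp
      have hnet : ∀ g : V → ℝ, g N.sink = 0 →
          N.net f₁ g = ∑ i ∈ s, g (n i) + g (N.tgt e) := by
        intro g hg
        rw [net_update, h g hg, he, Nat.cast_sub hfe]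
        push_cast
        ring
      obtain ⟨p, f', hp, hc, hn⟩ := ih _ hlt hnet rfl
      refine ⟨e :: p, f', ⟨he, hp⟩, fun e' => ?_, hn⟩
      rw [hf₁ e', hc e', List.count_cons (l := p), List.count_singleton]
      omega

/-- A flow in an acyclic network decomposes into paths to the sink. -/
theorem exists_path_decomposition [Fintype E] [DecidableEq E] (height : V → ℝ)
    (hh : ∀ e, height (N.src e) < height (N.tgt e)) {D : Type*}
    (n : D → V) (s : Finset D) {f : E → ℕ}
    (h : ∀ g : V → ℝ, g N.sink = 0 → N.net f g = ∑ i ∈ s, g (n i)) :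
    ∃ P : D → List E, (∀ i ∈ s, N.IsPath (n i) (P i)) ∧ ∀ e, f e = ∑ i ∈ s, (P i).count e := by
  classical
  induction s using Finset.induction_on generalizing f with
  | empty =>
    refine ⟨fun _ => [], by simp, fun e => ?_⟩
    -- Without supply there is only a circulation. Tested against the height, every term is
    -- nonpositive and the sum is zero, so acyclicity forces the flow to vanish.
    have h1 := h (fun v => height v - height N.sink) (sub_self _)
    rw [Finset.sum_empty] at h1
    have h2 : ∀ e ∈ Finset.univ, (f e : ℝ) * (height (N.src e) - height N.sink
        - (height (N.tgt e) - height N.sink)) ≤ 0 := fun e _ =>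
      mul_nonpos_of_nonneg_of_nonpos (Nat.cast_nonneg _) (by linarith [hh e])
    have h3 := (Finset.sum_eq_zero_iff_of_nonpos h2).1 h1 e (Finset.mem_univ _)
    rcases mul_eq_zero.1 h3 with h4 | h4
    · simpa using h4
    · linarith [hh e]
  | insert a s ha ih =>
    obtain ⟨p, f', hp, hc, hn⟩ := exists_path_of_net n s (v := n a) (f := f) (by
      intro g hg
      rw [h g hg, Finset.sum_insert ha, add_comm])
    obtain ⟨P, hP, hcP⟩ := ih hn
    have hu : ∀ i ∈ s, Function.update P a p i = P i := fun i hi =>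
      Function.update_of_ne (by rintro rfl; exact ha hi) _ _
    refine ⟨Function.update P a p, fun i hi => ?_, fun e => ?_⟩
    · rcases Finset.mem_insert.1 hi with rfl | hi
      · simpa using hp
      · rw [hu i hi]; exact hP i hi
    · rw [Finset.sum_insert ha, Function.update_self, hc, hcP, add_comm]
      congr 1
      exact Finset.sum_congr rfl fun i hi => by rw [hu i hi]

/-! ### Existence of compatible flows and the duality gap -/

/-- Every finite collection of supply nodes with edges to the sink has a compatible flow, provided
the zero flow is compatible with some potential. -/
theorem exists_compat_of_supply [Fintype V] [Fintype E] {φ₀ : V → ℝ} (h₀ : N.Compat 0 φ₀)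
    {D : Type*} (n : D → V) (s : Finset D)
    (hn : ∀ i ∈ s, ∃ e, N.src e = n i ∧ N.tgt e = N.sink ∧ e ∉ N.unit) :
    ∃ f φ, N.Compat f φ ∧ φ N.sink = φ₀ N.sink ∧
      ∀ g : V → ℝ, g N.sink = 0 → N.net f g = ∑ i ∈ s, g (n i) := by
  classical
  induction s using Finset.induction_on with
  | empty => exact ⟨0, φ₀, h₀, rfl, fun g _ => by simp [net]⟩
  | insert a s ha ih =>
    obtain ⟨f, φ, h1, h2, h3⟩ := ih fun i hi => hn i (Finset.mem_insert_of_mem hi)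
    obtain ⟨φ', f', -, h5, h6, h7⟩ := h1.exists_augmentation (hn a (Finset.mem_insert_self _ _))
    refine ⟨f', φ', h5, h6.trans h2, fun g hg => ?_⟩
    rw [h7, h3 g hg, hg, Finset.sum_insert ha]
    ring

/-- The terms of the duality gap between a flow and a potential. -/
theorem compat_of_gap_nonpos [Fintype E] {f : E → ℕ} {φ : V → ℝ} (hcap : ∀ e ∈ N.unit, f e ≤ 1)
    (hred : ∀ e ∉ N.unit, 0 ≤ N.red φ e) {u : E → ℝ} (hu : ∀ e ∈ N.unit, u e = max 0 (-N.red φ e))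
    (hu' : ∀ e ∉ N.unit, u e = 0) (hgap : ∑ e, (f e * N.red φ e + u e) ≤ 0) :
    N.Compat f φ := by
  -- Every term of the gap is nonnegative, so a nonpositive gap makes each vanish, which is
  -- complementary slackness edge by edge.
  have hnn : ∀ e ∈ Finset.univ, 0 ≤ f e * N.red φ e + u e := by
    intro e _
    by_cases he : e ∈ N.unit
    · rw [hu e he]
      have h1 := hcap e he
      interval_cases f e
      · simp
      · rw [Nat.cast_one, one_mul]; linarith [le_max_right 0 (-N.red φ e)]
    · rw [hu' e he, add_zero]
      exact mul_nonneg (Nat.cast_nonneg _) (hred e he)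
  have hz := fun e => (Finset.sum_eq_zero_iff_of_nonneg hnn).1
    (le_antisymm hgap (Finset.sum_nonneg hnn)) e (Finset.mem_univ e)
  refine ⟨hcap, fun e he => ?_, fun e he => ?_⟩
  · have h1 := hz e
    by_cases hue : e ∈ N.unit
    · have h2 : f e = 1 := le_antisymm (hcap e hue) he
      rw [hu e hue, h2, Nat.cast_one, one_mul] at h1
      linarith [le_max_left 0 (-N.red φ e)]
    · rw [hu' e hue, add_zero] at h1
      rcases mul_eq_zero.1 h1 with h2 | h2
      · have : f e = 0 := by exact_mod_cast h2
        omega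
      · exact h2.le
  · by_cases hue : e ∈ N.unit
    · have h1 := hz e
      rw [hu e hue, he hue, Nat.cast_zero, zero_mul, zero_add] at h1
      linarith [le_max_right 0 (-N.red φ e)]
    · exact hred e hue

/-- The value of a compatible flow. -/
theorem Compat.sum_gap_eq_zero [Fintype E] {f : E → ℕ} {φ : V → ℝ} (h : N.Compat f φ)
    {u : E → ℝ} (hu : ∀ e ∈ N.unit, u e = max 0 (-N.red φ e))
    (hu' : ∀ e ∉ N.unit, u e = 0) : ∑ e, (f e * N.red φ e + u e) = 0 := by
  refine Finset.sum_eq_zero fun e _ => ?_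
  rcases Nat.eq_zero_or_pos (f e) with h0 | h0
  · have h1 := h.red_nonneg e fun _ => h0
    by_cases hue : e ∈ N.unit
    · rw [hu e hue, h0, max_eq_left (by linarith)]; simp
    · rw [hu' e hue, h0]; simp
  · have h1 := h.red_nonpos e h0
    by_cases hue : e ∈ N.unit
    · have h2 : f e = 1 := le_antisymm (h.cap e hue) h0
      rw [hu e hue, h2, max_eq_right (by linarith)]; simp
    · rw [hu' e hue, le_antisymm h1 (h.red_nonneg e fun h => (hue h).elim)]; simp

theorem sum_mul_red [Fintype E] (f : E → ℕ) (φ : V → ℝ) :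
    ∑ e, (f e : ℝ) * N.red φ e = ∑ e, (f e : ℝ) * N.cost e + N.net f φ := by
  rw [net, ← Finset.sum_add_distrib]
  exact Finset.sum_congr rfl fun e _ => by rw [red]; ring

end FlowNetwork

/-! ### The time-expanded network of a market -/

namespace Market

variable {L D R : Type*}

/-- The nodes of the flow network: the sink `none`, and for each location and time a node for the
drivers on the platform (`true`) and one for those who may still stay out (`false`). -/
abbrev Node (M : Market L) : Type _ := Option (Bool × L × Fin (M.T + 1))

/-- The edges of the flow network: relocation trips, trips with a rider, exiting, entering the
platform and staying out. -/
inductive Edge (M : Market L) (R : Type*)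
  | trip (e : M.Trip)
  | rider (j : R)
  | exit (a : L) (t : Fin (M.T + 1))
  | enter (a : L) (t : Fin (M.T + 1))
  | stay (a : L) (t : Fin (M.T + 1))

instance instFiniteEdge [Finite L] [Finite R] (M : Market L) : Finite (M.Edge R) :=
  Finite.of_surjective
    (fun s : (M.Trip ⊕ R) ⊕ (L × Fin (M.T + 1)) × Fin 3 => match s with
      | .inl (.inl e) => Edge.trip e
      | .inl (.inr j) => Edge.rider j
      | .inr ((a, t), 0) => Edge.exit a t
      | .inr ((a, t), 1) => Edge.enter a t
      | .inr ((a, t), 2) => Edge.stay a t)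
    (fun e => match e with
      | .trip e => ⟨.inl (.inl e), rfl⟩
      | .rider j => ⟨.inl (.inr j), rfl⟩
      | .exit a t => ⟨.inr ((a, t), 0), rfl⟩
      | .enter a t => ⟨.inr ((a, t), 1), rfl⟩
      | .stay a t => ⟨.inr ((a, t), 2), rfl⟩)

theorem Trip.finish_lt {M : Market L} (e : M.Trip) : e.finish < M.T + 1 :=
  Nat.lt_succ_of_le e.end_le

theorem Trip.start_lt_finish {M : Market L} (e : M.Trip) : e.start < e.finish :=
  Nat.lt_add_of_pos_right (M.one_le_dist _ _)

/-- The node at which a trip starts. -/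
def Trip.origNode {M : Market L} (e : M.Trip) : M.Node :=
  some (true, e.orig, ⟨e.start, e.start_lt_finish.trans e.finish_lt⟩)

/-- The node at which a trip ends. -/
def Trip.destNode {M : Market L} (e : M.Trip) : M.Node :=
  some (true, e.dest, ⟨e.finish, e.finish_lt⟩)

/-- The node at which a driver becomes available. -/
def DriverType.node {M : Market L} (d : M.DriverType) : M.Node :=
  some (d.entered, d.loc, ⟨d.entry, Nat.lt_succ_of_le d.entry_le⟩)

/-- The flow network of a market, without the supply of drivers. -/
def network (M : Market L) (ρ : R → M.RiderType) : FlowNetwork M.Node (M.Edge R) where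
  src
    | .trip e => e.origNode
    | .rider j => (ρ j).trip.origNode
    | .exit a t => some (true, a, t)
    | .enter a t => some (false, a, t)
    | .stay a t => some (false, a, t)
  tgt
    | .trip e => e.destNode
    | .rider j => (ρ j).trip.destNode
    | .exit _ _ => none
    | .enter a t => some (true, a, t)
    | .stay _ _ => none
  sink := none
  cost
    | .trip e => e.tripCost
    | .rider j => (ρ j).trip.tripCost - (ρ j).value
    | .exit _ t => M.exitCost (M.T - t)
    | .enter _ _ => 0
    | .stay _ _ => 0
  unit := Set.range Edge.rider

/-- Dual feasible continuation values. -/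
structure IsPotential (M : Market L) (φ : M.Node → ℝ) : Prop where
  sink : φ none = 0
  trip : ∀ e : M.Trip, φ e.destNode ≤ e.tripCost + φ e.origNode
  exit : ∀ a (t : Fin (M.T + 1)), 0 ≤ M.exitCost (M.T - t) + φ (some (true, a, t))
  enter : ∀ a t, φ (some (true, a, t)) ≤ φ (some (false, a, t))
  stay : ∀ a t, 0 ≤ φ (some (false, a, t))

/-- The highest trip price that is consistent with the given continuation values. -/
def tripPrice {M : Market L} (φ : M.Node → ℝ) (e : M.Trip) : ℝ :=
  e.tripCost + φ e.origNode - φ e.destNode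

/-- The dual objective: total driver utility plus total rider utility. -/
noncomputable def dualValue {M : Market L} [Fintype D] [Fintype R] (θ : D → M.DriverType)
    (ρ : R → M.RiderType) (φ : M.Node → ℝ) : ℝ :=
  ∑ i, φ (θ i).node + ∑ j, max 0 ((ρ j).value - tripPrice φ (ρ j).trip)

variable {M : Market L}

/-! ### Weak duality -/

section WeakDuality

theorem IsPotential.tripPrice_nonneg {φ : M.Node → ℝ} (h : M.IsPotential φ) (e : M.Trip) :
    0 ≤ tripPrice φ e := by
  have := h.trip e
  unfold tripPrice
  linarith

/-- On each trip, price minus cost is the drop of `φ`, so the sum telescopes, and the exit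
constraint bounds the final term. -/
theorem IsPotential.route_le {φ : M.Node → ℝ} (h : M.IsPotential φ) {a : L} {t : ℕ}
    (ht : t < M.T + 1) {l : List M.Trip} (hl : M.IsRoute a t l) :
    (l.map (tripPrice φ)).sum -
      ((l.map Trip.tripCost).sum + M.exitCost (M.T - M.routeEnd t l)) ≤
      φ (some (true, a, ⟨t, ht⟩)) := by
  induction l generalizing a t with
  | nil =>
    have := h.exit a ⟨t, ht⟩
    simp only [List.map_nil, List.sum_nil, routeEnd]
    simp only at this
    linarith
  | cons e l ih =>
    obtain ⟨rfl, rfl, h3⟩ := hl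
    have h4 := ih e.finish_lt h3
    simp only [List.map_cons, List.sum_cons, routeEnd]
    have h5 : tripPrice φ e = e.tripCost + φ (some (true, e.orig, ⟨e.start, ht⟩))
      - φ (some (true, e.dest, ⟨e.finish, e.finish_lt⟩)) := rfl
    linarith

/-- For a driver who has not entered, the empty path is covered by the `stay` constraint and all
others by `enter` followed by `route_le`. -/
theorem IsPotential.path_le {φ : M.Node → ℝ} (h : M.IsPotential φ) (d : M.DriverType)
    (k : M.FeasiblePath d) :
    (k.1.map (tripPrice φ)).sum - M.pathCost d k.1 ≤ φ d.node := by
  have h1 := h.route_le (Nat.lt_succ_of_le d.entry_le) k.2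
  rcases d with ⟨s, a, t, t', ht, h2, h3⟩
  cases s with
  | true =>
    have : M.pathCost ⟨true, a, t, t', ht, h2, h3⟩ k.1 = (k.1.map Trip.tripCost).sum
      + M.exitCost (M.T - M.routeEnd t k.1) := if_neg (by simp)
    rw [this]
    exact h1
  | false =>
    by_cases hk : k.1 = []
    · have : M.pathCost ⟨false, a, t, t', ht, h2, h3⟩ k.1 = 0 := if_pos ⟨rfl, hk⟩
      rw [this, hk, List.map_nil, List.sum_nil, sub_zero]
      exact h.stay a ⟨t, Nat.lt_succ_of_le ht⟩
    · have : M.pathCost ⟨false, a, t, t', ht, h2, h3⟩ k.1 = (k.1.map Trip.tripCost).sum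
        + M.exitCost (M.T - M.routeEnd t k.1) := if_neg fun h => hk h.2
      rw [this]
      exact h1.trans (h.enter a ⟨t, Nat.lt_succ_of_le ht⟩)

theorem sum_map_eq_sum_ite [Fintype M.Trip] [DecidableEq M.Trip] {l : List M.Trip} (hl : l.Nodup)
    (q : M.Trip → ℝ) : (l.map q).sum = ∑ e, if e ∈ l then q e else 0 := by
  rw [← List.sum_toFinset _ hl, ← Finset.sum_filter]
  exact Finset.sum_congr (by ext; simp) fun _ _ => rfl

/-- Prices split the riders' values into surplus and payments. Capacity and nonnegative prices bound
the payments by the revenue of the paths, and `path_le` bounds revenue minus cost. -/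
theorem LPFeasible.objective_le [Finite L] [Fintype D] [Fintype R] {θ : D → M.DriverType}
    {ρ : R → M.RiderType} {x : R → ℝ} {y : ∀ i, M.FeasiblePath (θ i) → ℝ}
    (h : M.LPFeasible θ ρ x y) {φ : M.Node → ℝ} (hφ : M.IsPotential φ) :
    ∑ j, x j * (ρ j).value - ∑ i, ∑ k, y i k * M.pathCost (θ i) k.1 ≤ dualValue θ ρ φ := by
  classical
  have := Fintype.ofFinite M.Trip
  have h1 : ∑ j, x j * (ρ j).value ≤ ∑ j, x j * tripPrice φ (ρ j).trip
      + ∑ j, max 0 ((ρ j).value - tripPrice φ (ρ j).trip) := by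
    rw [← Finset.sum_add_distrib]
    refine Finset.sum_le_sum fun j _ => ?_
    have h2 : x j * ((ρ j).value - tripPrice φ (ρ j).trip)
        ≤ 1 * max 0 ((ρ j).value - tripPrice φ (ρ j).trip) :=
      (mul_le_mul_of_nonneg_left (le_max_right 0 _) (h.x_nonneg j)).trans
        (mul_le_mul_of_nonneg_right (h.x_le_one j) (le_max_left 0 _))
    linarith
  have h2 : ∑ j, x j * tripPrice φ (ρ j).trip
      ≤ ∑ i, ∑ k : M.FeasiblePath (θ i), y i k * (k.1.map (tripPrice φ)).sum := by
    calc ∑ j, x j * tripPrice φ (ρ j).trip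
        = ∑ j, ∑ e, (if (ρ j).trip = e then x j else 0) * tripPrice φ e := by
          refine Finset.sum_congr rfl fun j _ => ?_
          simp [ite_mul]
      _ = ∑ e, (∑ j, if (ρ j).trip = e then x j else 0) * tripPrice φ e := by
          rw [Finset.sum_comm]
          simp_rw [Finset.sum_mul]
      _ ≤ ∑ e : M.Trip, (∑ i, ∑ k : M.FeasiblePath (θ i), if e ∈ k.1 then y i k else 0)
            * tripPrice φ e :=
          Finset.sum_le_sum fun e _ =>
            mul_le_mul_of_nonneg_right (h.capacity e) (hφ.tripPrice_nonneg e)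
      _ = ∑ i, ∑ k : M.FeasiblePath (θ i), y i k * (k.1.map (tripPrice φ)).sum := by
          simp_rw [Finset.sum_mul]
          rw [Finset.sum_comm]
          refine Finset.sum_congr rfl fun i _ => ?_
          rw [Finset.sum_comm]
          refine Finset.sum_congr rfl fun k _ => ?_
          rw [sum_map_eq_sum_ite k.2.nodup, Finset.mul_sum]
          exact Finset.sum_congr rfl fun e _ => by split_ifs <;> simp
  have h3 : ∑ i, ∑ k : M.FeasiblePath (θ i), y i k * (k.1.map (tripPrice φ)).sum
      - ∑ i, ∑ k, y i k * M.pathCost (θ i) k.1 ≤ ∑ i, φ (θ i).node := by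
    rw [← Finset.sum_sub_distrib]
    refine Finset.sum_le_sum fun i _ => ?_
    rw [← Finset.sum_sub_distrib, ← one_mul (φ _), ← h.one_path i, Finset.sum_mul]
    refine Finset.sum_le_sum fun k _ => ?_
    rw [← mul_sub]
    exact mul_le_mul_of_nonneg_left (hφ.path_le (θ i) k) (h.y_nonneg i k)
  unfold dualValue
  linarith

end WeakDuality

/-! ### A starting potential, and finiteness of the welfare -/

section InitialPotential

theorem sum_value_ge [Fintype R] (ρ : R → M.RiderType) (j : R) :
    (ρ j).value ≤ ∑ j, (ρ j).value :=
  Finset.single_le_sum (f := fun j => (ρ j).value) (fun j _ => (ρ j).value_nonneg)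
    (Finset.mem_univ j)

/-- Continuation values so high that no rider needs to be served. -/
noncomputable def highPotential [Fintype R] (ρ : R → M.RiderType) : M.Node → ℝ
  | none => 0
  | some (_, _, t) => ((M.T : ℝ) - (t : ℕ)) * ∑ j, (ρ j).value

/-- Every trip lasts at least one period, so the potential drops along it by at least the total of
all rider values. Hence no rider edge has negative reduced cost. -/
theorem highPotential_compat [Fintype R] (ρ : R → M.RiderType) :
    (M.network ρ).Compat 0 (highPotential ρ) := by
  have hK : 0 ≤ ∑ j, (ρ j).value := Finset.sum_nonneg fun j _ => (ρ j).value_nonneg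
  have ht : ∀ t : Fin (M.T + 1), 0 ≤ ((M.T : ℝ) - (t : ℕ)) * ∑ j, (ρ j).value := fun t =>
    mul_nonneg (sub_nonneg.2 (Nat.cast_le.2 (Nat.le_of_lt_succ t.2))) hK
  have htrip : ∀ e : M.Trip, highPotential ρ e.destNode + ∑ j, (ρ j).value
      ≤ highPotential ρ e.origNode := by
    intro e
    have h1 : (e.start : ℝ) + 1 ≤ e.finish := by exact_mod_cast e.start_lt_finish
    simp only [highPotential, Trip.destNode, Trip.origNode]
    nlinarith
  refine ⟨by simp, by simp, fun e _ => ?_⟩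
  cases e with
  | trip e =>
    have h1 := htrip e
    have h2 : 0 ≤ e.tripCost := M.cost_nonneg _ _ _
    simp only [FlowNetwork.red, network]
    linarith
  | rider j =>
    have h1 := htrip (ρ j).trip
    have h2 : 0 ≤ (ρ j).trip.tripCost := M.cost_nonneg _ _ _
    have h3 := sum_value_ge ρ j
    simp only [FlowNetwork.red, network]
    linarith
  | exit a t =>
    have h1 := ht t
    have h2 := M.exitCost_nonneg (M.T - t)
    simp only [FlowNetwork.red, network, highPotential]
    linarith
  | enter a t => simp [FlowNetwork.red, network, highPotential]
  | stay a t =>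
    have h1 := ht t
    simp only [FlowNetwork.red, network, highPotential]
    linarith

/-- Only rider edges have bounded capacity. All other edges are always residual, and their
nonnegative reduced costs are the dual constraints. -/
theorem isPotential_of_compat {ρ : R → M.RiderType} {f : M.Edge R → ℕ} {φ : M.Node → ℝ}
    (h : (M.network ρ).Compat f φ) (h0 : φ none = 0) : M.IsPotential φ where
  sink := h0
  trip e := by
    have := h.red_nonneg (.trip e) (by simp [network])
    simp only [FlowNetwork.red, network] at this
    linarith
  exit a t := by
    have := h.red_nonneg (.exit a t) (by simp [network])
    simp only [FlowNetwork.red, network] at this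
    linarith
  enter a t := by
    have := h.red_nonneg (.enter a t) (by simp [network])
    simp only [FlowNetwork.red, network] at this
    linarith
  stay a t := by
    have := h.red_nonneg (.stay a t) (by simp [network])
    simp only [FlowNetwork.red, network] at this
    linarith

/-- Needed so that the `sSup` defining `socialWelfare` is a genuine supremum. -/
theorem bddAbove_objective [Finite L] [Fintype D] [Fintype R] (θ : D → M.DriverType)
    (ρ : R → M.RiderType) : BddAbove {w | ∃ x y, M.LPFeasible θ ρ x y ∧
    w = ∑ j, x j * (ρ j).value - ∑ i, ∑ k, y i k * M.pathCost (θ i) k.1} := by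
  refine ⟨dualValue θ ρ (highPotential ρ), ?_⟩
  rintro _ ⟨x, y, h, rfl⟩
  exact h.objective_le (isPotential_of_compat (highPotential_compat ρ) rfl)

theorem sum_feasiblePath_ite [Finite L] [DecidableEq (List M.Trip)] (d : M.DriverType)
    {l : List M.Trip} (hl : M.IsRoute d.loc d.entry l) (g : List M.Trip → ℝ) :
    ∑ k : M.FeasiblePath d, (if k.1 = l then g k.1 else 0) = g l :=
  (Fintype.sum_eq_single (α := M.FeasiblePath d) ⟨l, hl⟩
    (fun _ hb => if_neg fun h => hb (Subtype.ext h))).trans (if_pos rfl)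

theorem lpFeasible_empty_paths [Finite L] [Fintype D] [Fintype R] [DecidableEq (List M.Trip)]
    (θ : D → M.DriverType) (ρ : R → M.RiderType) :
    M.LPFeasible θ ρ 0 (fun _ k => if k.1 = [] then 1 else 0) where
  capacity e := by
    simp only [Pi.zero_apply, ite_self, Finset.sum_const_zero]
    exact Finset.sum_nonneg fun i _ => Finset.sum_nonneg fun k _ => by positivity
  one_path i := sum_feasiblePath_ite (θ i) (l := []) trivial fun _ => 1
  x_le_one := by simp
  x_nonneg := by simp
  y_nonneg i k := by positivity

theorem socialWelfare_le [Finite L] [Fintype D] [Fintype R] (θ : D → M.DriverType)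
    (ρ : R → M.RiderType) {φ : M.Node → ℝ} (hφ : M.IsPotential φ) :
    M.socialWelfare θ ρ ≤ dualValue θ ρ φ := by
  classical
  refine csSup_le ⟨_, _, _, lpFeasible_empty_paths θ ρ, rfl⟩ ?_
  rintro _ ⟨x, y, h, rfl⟩
  exact h.objective_le hφ

end InitialPotential

/-! ### Welfare of feasible plans and of equilibria -/

section PlanWelfare

variable {θ : D → M.DriverType} {ρ : R → M.RiderType}

/-- A route never repeats a trip, so a trip determines its step and hence the rider carried on it.
This yields the capacity constraint for plans. -/
theorem ActionPath.eq_of_serves {d : M.DriverType} (z : M.ActionPath ρ d) {j j' : R}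
    (h : z.Serves j) (h' : z.Serves j') (he : (ρ j).trip = (ρ j').trip) : j = j' := by
  have := List.inj_on_of_nodup_map z.isRoute.nodup h h' he
  simpa using (congrArg Prod.snd this)

open Classical in
theorem Plan.Feasible.lpFeasible [Finite L] [Fintype D] [Fintype R]
    {P : M.Plan θ ρ} (h : P.Feasible) :
    M.LPFeasible θ ρ (fun j => P.x j)
      (fun i k => if k.1 = (P.z i).steps.map Prod.fst then 1 else 0) where
  capacity e := by
    have h1 : ∀ j, (if (ρ j).trip = e then (P.x j : ℝ) else 0)
        = ∑ i, if (ρ j).trip = e ∧ (P.z i).Serves j then 1 else 0 := by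
      intro j
      rw [(h j).1]
      by_cases hj : (ρ j).trip = e <;> simp [hj]
    simp_rw [h1]
    rw [Finset.sum_comm]
    refine Finset.sum_le_sum fun i _ => ?_
    refine le_of_le_of_eq ?_ ((Finset.sum_congr rfl fun k _ => by split_ifs <;> rfl).trans
      (sum_feasiblePath_ite (θ i) (P.z i).isRoute fun l => if e ∈ l then 1 else 0)).symm
    rw [Finset.sum_boole]
    by_cases he : e ∈ (P.z i).steps.map Prod.fst
    · rw [if_pos he]
      have : (Finset.univ.filter fun j => (ρ j).trip = e ∧ (P.z i).Serves j).card ≤ 1 := by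
        rw [Finset.card_le_one]
        intro j hj j' hj'
        simp only [Finset.mem_filter, Finset.mem_univ, true_and] at hj hj'
        exact (P.z i).eq_of_serves hj.2 hj'.2 (hj.1.trans hj'.1.symm)
      exact_mod_cast this
    · rw [if_neg he, Finset.filter_eq_empty_iff.2]
      · simp
      · rintro j - ⟨rfl, hj⟩
        exact he (List.mem_map_of_mem (f := Prod.fst) hj)
  one_path i := sum_feasiblePath_ite (θ i) (P.z i).isRoute fun _ => 1
  x_le_one j := by
    rcases (h j).2 with h | h
    · simp [h]
    · rw [Set.mem_singleton_iff.1 h]; simp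
  x_nonneg j := by positivity
  y_nonneg i k := by positivity

theorem Plan.Feasible.welfare_le [Finite L] [Fintype D] [Fintype R]
    {P : M.Plan θ ρ} (h : P.Feasible) :
    ∑ j, (P.x j : ℝ) * (ρ j).value - ∑ i, (P.z i).actionCost ≤ M.socialWelfare θ ρ := by
  classical
  refine le_csSup (bddAbove_objective θ ρ) ⟨_, _, h.lpFeasible, ?_⟩
  congr 1
  refine Finset.sum_congr rfl fun i _ => ?_
  refine ((Finset.sum_congr rfl fun k _ => ?_).trans
    (sum_feasiblePath_ite (θ i) (P.z i).isRoute (M.pathCost (θ i)))).symm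
  split_ifs <;> simp

theorem Plan.Feasible.sum_driverPayment [Fintype D] [Fintype R]
    {P : M.Plan θ ρ} (h : P.Feasible) :
    ∑ i, P.driverPayment i = ∑ j, (P.x j : ℝ) * P.price (ρ j).trip := by
  classical
  unfold Plan.driverPayment
  rw [Finset.sum_comm]
  refine Finset.sum_congr rfl fun j _ => ?_
  rw [(h j).1]
  push_cast
  rw [Finset.sum_mul]
  refine Finset.sum_congr rfl fun i _ => ?_
  split_ifs <;> simp

/-- The welfare of a competitive equilibrium is the total utility of drivers and riders. -/
theorem Plan.IsCE.sum_utility_le [Finite L] [Fintype D] [Fintype R]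
    {P : M.Plan θ ρ} (h : P.IsCE) :
    ∑ i, P.utility i + ∑ j, max 0 ((ρ j).value - P.price (ρ j).trip) ≤ M.socialWelfare θ ρ := by
  refine le_trans (le_of_eq ?_) h.feasible.welfare_le
  -- The two rider conditions make `x j` times value minus price equal to the positive part of that
  -- difference.
  have h1 : ∀ j, max 0 ((ρ j).value - P.price (ρ j).trip)
      = (P.x j : ℝ) * (ρ j).value - (P.x j : ℝ) * P.price (ρ j).trip := by
    intro j
    rcases (h.feasible j).2 with h0 | h0
    · rw [h0, max_eq_left]
      · simp
      · by_contra! hlt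
        have := h.picked_up j (by linarith)
        omega
    · have h0 : P.x j = 1 := h0
      rw [h0, max_eq_right]
      · simp
      · have := h.affordable j h0
        linarith
  simp_rw [h1]
  rw [Finset.sum_sub_distrib, ← h.feasible.sum_driverPayment]
  simp only [Plan.utility, Finset.sum_sub_distrib]
  ring

end PlanWelfare

/-! ### From equilibria to optimal potentials -/

section ValueFunction

/-- A driver type with the given entrance, who leaves after the end of the horizon. -/
def driverAt (M : Market L) (s : Bool) (a : L) (t : Fin (M.T + 1)) : M.DriverType where
  entered := s
  loc := a
  entry := t
  exit := M.T + 1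
  entry_le := Nat.le_of_lt_succ t.2
  entry_lt_exit := t.2
  horizon_le_exit := Nat.le_succ _

/-- The payoff of a path at the trip prices `q`. -/
noncomputable def pathValue (q : M.Trip → ℝ) (d : M.DriverType) (l : List M.Trip) : ℝ :=
  (l.map q).sum - M.pathCost d l

/-- The highest payoff from each node at the trip prices `q`. -/
noncomputable def valueFunction (q : M.Trip → ℝ) : M.Node → ℝ
  | none => 0
  | some (s, a, t) => ⨆ k : M.FeasiblePath (M.driverAt s a t), pathValue q (M.driverAt s a t) k.1

theorem pathValue_le_valueFunction [Finite L]
    (q : M.Trip → ℝ) (s : Bool) (a : L) (t : Fin (M.T + 1))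
    (l : List M.Trip) (hl : M.IsRoute a t l) :
    pathValue q (M.driverAt s a t) l ≤ valueFunction q (some (s, a, t)) :=
  le_ciSup (f := fun k : M.FeasiblePath (M.driverAt s a t) =>
    pathValue q (M.driverAt s a t) k.1) (Set.finite_range _).bddAbove ⟨l, hl⟩

theorem valueFunction_le (q : M.Trip → ℝ) (s : Bool) (a : L) (t : Fin (M.T + 1)) {c : ℝ}
    (h : ∀ l, M.IsRoute a t l → pathValue q (M.driverAt s a t) l ≤ c) :
    valueFunction q (some (s, a, t)) ≤ c :=
  haveI : Nonempty (M.FeasiblePath (M.driverAt s a t)) := ⟨⟨[], trivial⟩⟩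
  ciSup_le fun k => h k.1 k.2

/-- `d` and the `driverAt` type at its node may differ in their exit times, but neither routes nor
path costs depend on these. -/
theorem valueFunction_node [Finite L] (q : M.Trip → ℝ) (d : M.DriverType) {u : ℝ}
    (h : IsGreatest (Set.range fun k : M.FeasiblePath d => pathValue q d k.1) u) :
    valueFunction q d.node = u := by
  obtain ⟨⟨k, hk⟩, hu⟩ := h
  refine le_antisymm (valueFunction_le q _ _ _ fun l hl => hu ⟨⟨l, hl⟩, rfl⟩) ?_
  rw [← hk]
  exact pathValue_le_valueFunction q d.entered d.loc
    ⟨d.entry, Nat.lt_succ_of_le d.entry_le⟩ k.1 k.2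

theorem pathCost_driverAt_true (a : L) (t : Fin (M.T + 1)) (l : List M.Trip) :
    M.pathCost (M.driverAt true a t) l
      = (l.map Trip.tripCost).sum + M.exitCost (M.T - M.routeEnd t l) :=
  if_neg (by simp [driverAt])

/-- Dynamic programming: prepending `e` to a route from its destination gives a route from its
origin. -/
theorem trip_add_valueFunction_le [Finite L] (q : M.Trip → ℝ) (e : M.Trip) :
    q e + valueFunction q e.destNode ≤ e.tripCost + valueFunction q e.origNode := by
  suffices h : valueFunction q e.destNode ≤ e.tripCost + valueFunction q e.origNode - q e by
    linarith
  refine valueFunction_le q _ _ _ fun l hl => ?_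
  have h1 := pathValue_le_valueFunction q true e.orig
    ⟨e.start, e.start_lt_finish.trans e.finish_lt⟩ (e :: l) ⟨rfl, rfl, hl⟩
  change _ ≤ valueFunction q e.origNode at h1
  simp only [pathValue, pathCost_driverAt_true, List.map_cons, List.sum_cons, routeEnd] at h1 ⊢
  linarith

theorem isPotential_valueFunction [Finite L] {q : M.Trip → ℝ} (hq : ∀ e, 0 ≤ q e) :
    M.IsPotential (valueFunction q) where
  sink := rfl
  trip e := by linarith [hq e, trip_add_valueFunction_le q e]
  exit a t := by
    have := pathValue_le_valueFunction q true a t [] trivial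
    simp only [pathValue, pathCost_driverAt_true, List.map_nil, List.sum_nil, routeEnd] at this
    linarith
  enter a t := by
    refine valueFunction_le q _ _ _ fun l hl => ?_
    refine le_trans ?_ (pathValue_le_valueFunction q false a t l hl)
    unfold pathValue
    refine sub_le_sub_left ?_ _
    rw [pathCost_driverAt_true, pathCost]
    split_ifs with h
    · rw [h.2]
      simpa using M.exitCost_nonneg _
    · exact le_rfl
  stay a t := by
    refine le_trans ?_ (pathValue_le_valueFunction q false a t [] trivial)
    simp [pathValue, pathCost, driverAt]

/-- The driver utilities of a competitive equilibrium come from an optimal dual solution. -/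
theorem Plan.IsCE.exists_potential [Finite L] [Fintype D] [Fintype R] {θ : D → M.DriverType}
    {ρ : R → M.RiderType} {P : M.Plan θ ρ} (h : P.IsCE) :
    ∃ φ, M.IsPotential φ ∧ dualValue θ ρ φ ≤ M.socialWelfare θ ρ ∧
      ∀ i, P.utility i = φ (θ i).node := by
  set q : M.Trip → ℝ := fun e => max (P.price e) 0
  have hu : ∀ i, valueFunction q (θ i).node = P.utility i := fun i =>
    valueFunction_node q (θ i) (h.driver_best_response i)
  refine ⟨valueFunction q, isPotential_valueFunction fun e => le_max_right _ _, ?_,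
    fun i => (hu i).symm⟩
  refine le_trans ?_ h.sum_utility_le
  unfold dualValue
  simp_rw [hu]
  -- The price induced by the value function is at least `q`, hence at least the equilibrium price,
  -- so rider surplus can only shrink.
  refine add_le_add_right (Finset.sum_le_sum fun j _ => max_le_max le_rfl ?_) _
  have h1 := trip_add_valueFunction_le q (ρ j).trip
  have h2 : P.price (ρ j).trip ≤ q (ρ j).trip := le_max_left _ _
  unfold tripPrice
  linarith

end ValueFunction

/-! ### From compatible flows to equilibrium plans -/

section PathsToPlans

/-- The step of an action path that an edge of the network stands for. -/
def Edge.step (ρ : R → M.RiderType) : M.Edge R → Option (M.Trip × Option R)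
  | .trip e => some (e, none)
  | .rider j => some ((ρ j).trip, some j)
  | .exit _ _ => none
  | .enter _ _ => none
  | .stay _ _ => none

/-- The cost of an edge to the driver who uses it. -/
def Edge.travelCost (ρ : R → M.RiderType) : M.Edge R → ℝ
  | .trip e => e.tripCost
  | .rider j => (ρ j).trip.tripCost
  | .exit _ t => M.exitCost (M.T - t)
  | .enter _ _ => 0
  | .stay _ _ => 0

/-- The payment to a driver for using an edge. -/
def Edge.payment (ρ : R → M.RiderType) (q : M.Trip → ℝ) : M.Edge R → ℝ
  | .rider j => q (ρ j).trip
  | _ => 0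

/-- The utility of the rider who uses an edge. -/
noncomputable def Edge.riderSurplus (ρ : R → M.RiderType) (φ : M.Node → ℝ) : M.Edge R → ℝ
  | .rider j => max 0 ((ρ j).value - tripPrice φ (ρ j).trip)
  | _ => 0

variable {ρ : R → M.RiderType}

theorem eq_nil_of_isPath_none {p : List (M.Edge R)} (h : (M.network ρ).IsPath none p) :
    p = [] := by
  cases p with
  | nil => rfl
  | cons e p =>
    have := h.1
    cases e <;> simp [network, Trip.origNode] at this

theorem isRoute_of_isPath {s : Bool} {a : L} {t : Fin (M.T + 1)} {p : List (M.Edge R)}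
    (h : (M.network ρ).IsPath (some (s, a, t)) p) :
    M.IsRoute a t ((p.filterMap (Edge.step ρ)).map Prod.fst) := by
  induction p generalizing s a t with
  | nil => exact trivial
  | cons e p ih =>
    obtain ⟨h1, h2⟩ := h
    cases e with
    | trip e =>
      simp only [network, Trip.origNode, Option.some.injEq, Prod.mk.injEq] at h1
      obtain ⟨-, rfl, rfl⟩ := h1
      exact ⟨rfl, rfl, ih h2⟩
    | rider j =>
      simp only [network, Trip.origNode, Option.some.injEq, Prod.mk.injEq] at h1
      obtain ⟨-, rfl, rfl⟩ := h1
      exact ⟨rfl, rfl, ih h2⟩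
    | exit a' t' =>
      rw [eq_nil_of_isPath_none h2]
      exact trivial
    | enter a' t' =>
      simp only [network, Option.some.injEq, Prod.mk.injEq] at h1
      obtain ⟨-, rfl, rfl⟩ := h1
      exact ih h2
    | stay a' t' =>
      rw [eq_nil_of_isPath_none h2]
      exact trivial

/-- A path from an on-platform node reaches the sink only by an exit edge, which lies at the time
when the route ends. -/
theorem sum_travelCost_of_isPath {a : L} {t : Fin (M.T + 1)} {p : List (M.Edge R)}
    (h : (M.network ρ).IsPath (some (true, a, t)) p) :
    (p.map (Edge.travelCost ρ)).sum =
      (((p.filterMap (Edge.step ρ)).map Prod.fst).map Trip.tripCost).sum +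
        M.exitCost (M.T - M.routeEnd t ((p.filterMap (Edge.step ρ)).map Prod.fst)) := by
  induction p generalizing a t with
  | nil => exact absurd h (by simp [FlowNetwork.IsPath, network])
  | cons e p ih =>
    obtain ⟨h1, h2⟩ := h
    cases e with
    | trip e =>
      simp [Edge.travelCost, Edge.step, routeEnd, ih h2, add_assoc]
    | rider j =>
      simp [Edge.travelCost, Edge.step, routeEnd, ih h2, add_assoc]
    | exit a' t' =>
      simp only [network, Option.some.injEq, Prod.mk.injEq, true_and] at h1
      obtain ⟨rfl, rfl⟩ := h1
      rw [eq_nil_of_isPath_none h2]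
      simp [Edge.travelCost, Edge.step, List.filterMap_cons, routeEnd]
    | enter a' t' => simp [network] at h1
    | stay a' t' => simp [network] at h1

/-- Equality can fail: entering and exiting at once pays the exit cost in the network, but the
resulting empty action path costs nothing. -/
theorem pathCost_le_sum_travelCost {d : M.DriverType} {p : List (M.Edge R)}
    (h : (M.network ρ).IsPath d.node p) :
    M.pathCost d ((p.filterMap (Edge.step ρ)).map Prod.fst) ≤
      (p.map (Edge.travelCost ρ)).sum := by
  rcases d with ⟨s, a, t, t', h1, h2, h3⟩
  cases s with
  | true =>
    rw [pathCost, if_neg (by simp)]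
    exact (sum_travelCost_of_isPath h).ge
  | false =>
    cases p with
    | nil => exact absurd h (by simp [FlowNetwork.IsPath, network, DriverType.node])
    | cons e p =>
      obtain ⟨h4, h5⟩ := h
      cases e with
      | enter a' t' =>
        simp only [network, DriverType.node, Option.some.injEq, Prod.mk.injEq, true_and] at h4
        obtain ⟨rfl, rfl⟩ := h4
        have h6 := sum_travelCost_of_isPath h5
        simp only [List.filterMap_cons, Edge.step, List.map_cons, List.sum_cons,
          Edge.travelCost, zero_add, h6, pathCost]
        split_ifs with h7
        · rw [h7.2]
          simpa using M.exitCost_nonneg _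
        · exact le_rfl
      | stay a' t' =>
        rw [eq_nil_of_isPath_none h5]
        simp [Edge.step, Edge.travelCost, pathCost]
      | trip e => simp [network, DriverType.node, Trip.origNode] at h4
      | rider j => simp [network, DriverType.node, Trip.origNode] at h4
      | exit a' t' => simp [network, DriverType.node] at h4

/-- Payment minus travel cost is the drop of `φ` on every edge: on rider edges by definition of
`tripPrice`, on the others because they are tight. The sum telescopes. -/
theorem sum_payment_sub_travelCost {φ : M.Node → ℝ} {v : M.Node} {p : List (M.Edge R)}
    (h : (M.network ρ).IsPath v p)
    (ht : ∀ e ∈ p, e ∉ (M.network ρ).unit → (M.network ρ).red φ e = 0) :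
    (p.map (Edge.payment ρ (tripPrice φ))).sum - (p.map (Edge.travelCost ρ)).sum
      = φ v - φ none := by
  induction p generalizing v with
  | nil =>
    obtain rfl : v = none := h
    simp
  | cons e p ih =>
    obtain ⟨rfl, h2⟩ := h
    have h3 := ih h2 fun e he => ht e (List.mem_cons_of_mem _ he)
    have h4 : Edge.payment ρ (tripPrice φ) e - Edge.travelCost ρ e
        = φ ((M.network ρ).src e) - φ ((M.network ρ).tgt e) := by
      have h5 := ht e List.mem_cons_self
      cases e with
      | rider j =>
        simp only [Edge.payment, Edge.travelCost, tripPrice, network]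
        ring
      | trip e =>
        have := h5 (by simp [network])
        simp only [FlowNetwork.red, network, Edge.payment, Edge.travelCost] at this ⊢
        linarith
      | exit a t =>
        have := h5 (by simp [network])
        simp only [FlowNetwork.red, network, Edge.payment, Edge.travelCost] at this ⊢
        linarith
      | enter a t =>
        have := h5 (by simp [network])
        simp only [FlowNetwork.red, network, Edge.payment, Edge.travelCost] at this ⊢
        linarith
      | stay a t =>
        have := h5 (by simp [network])
        simp only [FlowNetwork.red, network, Edge.payment, Edge.travelCost] at this ⊢
        linarith
    simp only [List.map_cons, List.sum_cons]
    linarith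

/-- Relocation trips earn nothing in the plan, whereas the best-response benchmark credits them with
their nonnegative price. -/
theorem sum_payment_le {q : M.Trip → ℝ} (hq : ∀ e, 0 ≤ q e) (p : List (M.Edge R)) :
    (p.map (Edge.payment ρ q)).sum ≤
      (((p.filterMap (Edge.step ρ)).map Prod.fst).map q).sum := by
  induction p with
  | nil => simp
  | cons e p ih =>
    cases e with
    | trip e =>
      simp only [Edge.step, Edge.payment, List.map_cons, List.sum_cons, Option.some.injEq,
        List.filterMap_cons_some]
      linarith [hq e]
    | rider j => simpa [Edge.step, Edge.payment] using ih
    | exit a t => simpa [Edge.step, List.filterMap_cons, Edge.payment] using ih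
    | enter a t => simpa [Edge.step, List.filterMap_cons, Edge.payment] using ih
    | stay a t => simpa [Edge.step, List.filterMap_cons, Edge.payment] using ih

theorem mem_filterMap_step {p : List (M.Edge R)} {e : M.Trip} {j : R} :
    (e, some j) ∈ p.filterMap (Edge.step ρ) ↔ e = (ρ j).trip ∧ Edge.rider j ∈ p := by
  rw [List.mem_filterMap]
  constructor
  · rintro ⟨e', h1, h2⟩
    cases e' <;> simp [Edge.step] at h2
    obtain ⟨rfl, rfl⟩ := h2
    exact ⟨rfl, h1⟩
  · rintro ⟨rfl, h⟩
    exact ⟨_, h, rfl⟩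

theorem rider_injective : Function.Injective (Edge.rider : R → M.Edge R) :=
  fun _ _ h => Edge.rider.inj h

open Classical in
theorem sum_payment_eq [Fintype R] {q : M.Trip → ℝ} {p : List (M.Edge R)}
    (hp : ∀ j, p.count (Edge.rider j) ≤ 1) :
    (p.map (Edge.payment ρ q)).sum = ∑ j, if Edge.rider j ∈ p then q (ρ j).trip else 0 := by
  rw [Finset.sum_list_map_count, ← Finset.sum_filter]
  symm
  refine Finset.sum_of_injOn Edge.rider rider_injective.injOn ?_ ?_ ?_
  · intro j hj
    simpa using hj
  · intro e he hne
    cases e with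
    | rider j => exact absurd ⟨j, by simpa using he, rfl⟩ hne
    | _ => simp [Edge.payment]
  · intro j hj
    have h1 : 0 < p.count (Edge.rider j) := List.count_pos_iff.2 (by simpa using hj)
    have h2 : p.count (Edge.rider j) = 1 := le_antisymm (hp j) h1
    rw [h2, one_smul]
    rfl

/-- The action path that follows a path of the network. -/
def actionPathOfPath {d : M.DriverType} {p : List (M.Edge R)}
    (h : (M.network ρ).IsPath d.node p) : M.ActionPath ρ d where
  steps := p.filterMap (Edge.step ρ)
  isRoute := isRoute_of_isPath h
  rider_trip _ _ he := (mem_filterMap_step.1 he).1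

theorem actionPathOfPath_serves {d : M.DriverType} {p : List (M.Edge R)}
    (h : (M.network ρ).IsPath d.node p) (j : R) :
    (actionPathOfPath h).Serves j ↔ Edge.rider j ∈ p := by
  unfold ActionPath.Serves actionPathOfPath
  rw [mem_filterMap_step]
  simp

/-- Times at the nodes, which increase along all edges. -/
def nodeHeight : M.Node → ℝ
  | none => M.T + 2
  | some (s, _, t) => (t : ℕ) + if s then 1 else 0

theorem nodeHeight_lt (e : M.Edge R) :
    nodeHeight ((M.network ρ).src e) < nodeHeight ((M.network ρ).tgt e) := by
  have ht : ∀ t : Fin (M.T + 1), ((t : ℕ) : ℝ) ≤ M.T := fun t =>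
    Nat.cast_le.2 (Nat.le_of_lt_succ t.2)
  cases e with
  | trip e => simpa [network, nodeHeight, Trip.origNode, Trip.destNode] using e.start_lt_finish
  | rider j =>
    simpa [network, nodeHeight, Trip.origNode, Trip.destNode] using (ρ j).trip.start_lt_finish
  | exit a t =>
    simp only [network, nodeHeight, if_true]
    linarith [ht t]
  | enter a t => simp [network, nodeHeight]
  | stay a t =>
    simp only [network, nodeHeight, Bool.false_eq_true, if_false]
    linarith [ht t]

/-- A compatible flow and potential yield a competitive equilibrium. -/
theorem exists_isCE_of_compat [Finite L] [Fintype D] [Fintype R] [Fintype (M.Edge R)]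
    {θ : D → M.DriverType} {f : M.Edge R → ℕ} {φ : M.Node → ℝ}
    (h : (M.network ρ).Compat f φ) (h0 : φ none = 0)
    (hf : ∀ g : M.Node → ℝ, g none = 0 → (M.network ρ).net f g = ∑ i, g (θ i).node) :
    ∃ P : M.Plan θ ρ, P.IsCE ∧ P.price = tripPrice φ ∧ ∀ i, P.utility i = φ (θ i).node := by
  classical
  obtain ⟨p, hp, hcount⟩ := FlowNetwork.exists_path_decomposition nodeHeight nodeHeight_lt
    (fun i => (θ i).node) Finset.univ hf
  replace hp : ∀ i, (M.network ρ).IsPath (θ i).node (p i) := fun i => hp i (Finset.mem_univ i)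
  have hφ := isPotential_of_compat h h0
  have hle : ∀ i e, (p i).count e ≤ f e := fun i e => by
    rw [hcount e]
    exact Finset.single_le_sum (f := fun i => (p i).count e) (fun _ _ => Nat.zero_le _)
      (Finset.mem_univ i)
  have hone : ∀ j, f (.rider j) ≤ 1 := fun j => h.cap _ ⟨j, rfl⟩
  have hxf : ∀ j, f (.rider j) = ∑ i, if (actionPathOfPath (hp i)).Serves j then 1 else 0 := by
    intro j
    rw [hcount]
    refine Finset.sum_congr rfl fun i _ => ?_
    have h1 := (hle i (.rider j)).trans (hone j)
    simp only [actionPathOfPath_serves]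
    split_ifs with h2
    · exact le_antisymm h1 (List.count_pos_iff.2 h2)
    · exact List.count_eq_zero.2 h2
  let P : M.Plan θ ρ := ⟨fun j => f (.rider j), fun i => actionPathOfPath (hp i), tripPrice φ⟩
  let k : ∀ i, M.FeasiblePath (θ i) := fun i => ⟨_, (P.z i).isRoute⟩
  have hpay : ∀ i, P.driverPayment i = ((p i).map (Edge.payment ρ (tripPrice φ))).sum := by
    intro i
    rw [sum_payment_eq fun j => (hle i _).trans (hone j), Plan.driverPayment]
    refine Finset.sum_congr rfl fun j _ => ?_
    simp only [P, actionPathOfPath_serves]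
  -- `hlow`, `hmid` and `hup` close a cycle from `φ` to the utility, to the payoff of the underlying
  -- path, and back to `φ`. Equality throughout is the best-response condition.
  have hlow : ∀ i, φ (θ i).node ≤ P.utility i := by
    intro i
    have h1 := sum_payment_sub_travelCost (φ := φ) (hp i) fun e he hue =>
      le_antisymm (h.red_nonpos e ((List.count_pos_iff.2 he).trans_le (hle i e)))
        (h.red_nonneg e fun h => (hue h).elim)
    have h2 : (P.z i).actionCost ≤ _ := pathCost_le_sum_travelCost (hp i)
    rw [Plan.utility, hpay]
    linarith
  have hmid : ∀ i, P.utility i ≤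
      ((k i).1.map (tripPrice φ)).sum - M.pathCost (θ i) (k i).1 := by
    intro i
    rw [Plan.utility, hpay]
    exact sub_le_sub_right (sum_payment_le hφ.tripPrice_nonneg (p i)) _
  have hup := fun i => hφ.path_le (θ i) (k i)
  have hu : ∀ i, P.utility i = φ (θ i).node := fun i =>
    le_antisymm ((hmid i).trans (hup i)) (hlow i)
  have hmax : (fun e => max (P.price e) 0) = tripPrice φ :=
    funext fun e => max_eq_left (hφ.tripPrice_nonneg e)
  refine ⟨P, ⟨fun j => ⟨hxf j, ?_⟩, fun j hj => ?_, fun j hj => ?_, fun i => ⟨⟨k i, ?_⟩, ?_⟩⟩,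
    rfl, hu⟩
  · have := hone j
    change f (.rider j) = 0 ∨ f (.rider j) = 1
    omega
  · by_contra hne
    have h1 : f (.rider j) = 0 := by
      have := hone j
      change f (.rider j) ≠ 1 at hne
      omega
    have h2 := h.red_nonneg (.rider j) fun _ => h1
    simp only [FlowNetwork.red, network] at h2
    simp only [P, tripPrice] at hj
    linarith
  · have h1 : f (.rider j) = 1 := hj
    have h2 := h.red_nonpos (.rider j) (by omega)
    simp only [FlowNetwork.red, network] at h2
    simp only [P, tripPrice]
    linarith
  · rw [hmax]
    exact le_antisymm ((hup i).trans (hlow i)) (hmid i)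
  · rintro _ ⟨k', rfl⟩
    rw [hmax, hu]
    exact hφ.path_le (θ i) k'

end PathsToPlans

/-! ### Equilibrium utilities as optimal dual values -/

section Characterization

variable {θ : D → M.DriverType} {ρ : R → M.RiderType}

/-- The flow yields an equilibrium at the prices `tripPrice φ`, whose total utility is the dual
value and is at most the welfare. -/
theorem dualValue_le_of_compat [Finite L] [Fintype D] [Fintype R]
    [Fintype (M.Edge R)] {f : M.Edge R → ℕ} {φ : M.Node → ℝ}
    (h : (M.network ρ).Compat f φ) (h0 : φ none = 0)
    (hf : ∀ g : M.Node → ℝ, g none = 0 → (M.network ρ).net f g = ∑ i, g (θ i).node) :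
    dualValue θ ρ φ ≤ M.socialWelfare θ ρ := by
  obtain ⟨P, h1, h2, h3⟩ := exists_isCE_of_compat h h0 hf
  have h4 := h1.sum_utility_le
  simp_rw [h2, h3] at h4
  exact h4

/-- The duality gap of a flow with the supply of the drivers. -/
theorem sum_gap_eq [Fintype D] [Fintype R] [Fintype (M.Edge R)] {f : M.Edge R → ℕ}
    (hf : ∀ g : M.Node → ℝ, g none = 0 → (M.network ρ).net f g = ∑ i, g (θ i).node)
    {φ : M.Node → ℝ} (h0 : φ none = 0) :
    ∑ e, (f e * (M.network ρ).red φ e +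
        e.riderSurplus ρ φ) =
      ∑ e, (f e : ℝ) * (M.network ρ).cost e + dualValue θ ρ φ := by
  rw [Finset.sum_add_distrib, FlowNetwork.sum_mul_red, hf φ h0, dualValue, ← add_assoc]
  congr 1
  symm
  refine Fintype.sum_of_injective Edge.rider rider_injective _ _ ?_ fun j => rfl
  intro e he
  cases e with
  | rider j => exact absurd ⟨j, rfl⟩ he
  | _ => rfl

theorem riderSurplus_of_mem_unit (φ : M.Node → ℝ) {e : M.Edge R} (he : e ∈ (M.network ρ).unit) :
    e.riderSurplus ρ φ = max 0 (-(M.network ρ).red φ e) := by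
  obtain ⟨j, rfl⟩ := he
  simp only [Edge.riderSurplus, FlowNetwork.red, network, tripPrice]
  congr 1
  ring

theorem riderSurplus_of_notMem_unit (φ : M.Node → ℝ) {e : M.Edge R}
    (he : e ∉ (M.network ρ).unit) : e.riderSurplus ρ φ = 0 := by
  cases e with
  | rider j => exact absurd ⟨j, rfl⟩ he
  | _ => rfl

theorem IsPotential.red_nonneg {φ : M.Node → ℝ} (h : M.IsPotential φ) {e : M.Edge R}
    (he : e ∉ (M.network ρ).unit) : 0 ≤ (M.network ρ).red φ e := by
  cases e with
  | rider j => exact absurd ⟨j, rfl⟩ he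
  | trip e =>
    have := h.trip e
    simp only [FlowNetwork.red, network]
    linarith
  | exit a t =>
    have := h.exit a t
    simp only [FlowNetwork.red, network, h.sink]
    linarith
  | enter a t =>
    have := h.enter a t
    simp only [FlowNetwork.red, network]
    linarith
  | stay a t =>
    have := h.stay a t
    simp only [FlowNetwork.red, network, h.sink]
    linarith

/-- The option to exit or stay out supplies the unbounded edge to the sink on which augmentation
relies. -/
theorem exists_edge_to_sink (d : M.DriverType) : ∃ e : M.Edge R,
    (M.network ρ).src e = d.node ∧ (M.network ρ).tgt e = (M.network ρ).sink ∧
      e ∉ (M.network ρ).unit := by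
  rcases d with ⟨s, a, t, t', h1, h2, h3⟩
  cases s with
  | true => exact ⟨.exit a ⟨t, Nat.lt_succ_of_le h1⟩, rfl, rfl, by simp [network]⟩
  | false => exact ⟨.stay a ⟨t, Nat.lt_succ_of_le h1⟩, rfl, rfl, by simp [network]⟩

variable (θ ρ) in
theorem exists_compat [Finite L] [Fintype D] [Fintype R]
    [Fintype (M.Edge R)] : ∃ f φ, (M.network ρ).Compat f φ ∧ φ none = 0 ∧
    ∀ g : M.Node → ℝ, g none = 0 → (M.network ρ).net f g = ∑ i, g (θ i).node :=
  haveI := Fintype.ofFinite M.Node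
  FlowNetwork.exists_compat_of_supply (highPotential_compat ρ) (fun i => (θ i).node) Finset.univ
    fun i _ => exists_edge_to_sink (θ i)

/-- Driver utilities in competitive equilibrium are the continuation values in optimal dual
solutions. -/
theorem mem_ceUtilities_iff [Finite L] [Fintype D] [Fintype R]
    {π : D → ℝ} : π ∈ M.ceUtilities θ ρ ↔
    ∃ φ, M.IsPotential φ ∧ dualValue θ ρ φ ≤ M.socialWelfare θ ρ ∧ ∀ i, π i = φ (θ i).node := by
  have := Fintype.ofFinite (M.Edge R)
  constructor
  · rintro ⟨P, hP, hu⟩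
    obtain ⟨φ, h1, h2, h3⟩ := hP.exists_potential
    exact ⟨φ, h1, h2, fun i => (hu i).trans (h3 i)⟩
  · rintro ⟨φ, h1, h2, h3⟩
    -- The cost of `f` is minus the dual value of `ψ`, hence at most minus the welfare. So the gap
    -- between `f` and the optimal `φ` is nonpositive, and `f` is compatible with `φ` too.
    obtain ⟨f, ψ, hc, h0, hf⟩ := exists_compat θ ρ
    have h4 := hc.sum_gap_eq_zero (fun e he => riderSurplus_of_mem_unit ψ he)
      (fun e he => riderSurplus_of_notMem_unit ψ he)
    have h5 := socialWelfare_le θ ρ (isPotential_of_compat hc h0)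
    rw [sum_gap_eq hf h0] at h4
    have hcφ : (M.network ρ).Compat f φ :=
      FlowNetwork.compat_of_gap_nonpos hc.cap (fun e he => h1.red_nonneg he)
        (fun e he => riderSurplus_of_mem_unit φ he) (fun e he => riderSurplus_of_notMem_unit φ he)
        (by rw [sum_gap_eq hf h1.sink]; linarith)
    obtain ⟨P, hP, -, hu⟩ := exists_isCE_of_compat hcφ h1.sink hf
    exact ⟨P, hP, fun i => (h3 i).trans (hu i).symm⟩

variable (θ ρ) in
/-- Some continuation values are optimal both with and without an additional driver. -/
theorem exists_common_potential [Finite L] [Fintype D] [Fintype R]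
    {D' : Type*} [Fintype D'] (θ' : D' → M.DriverType)
    (d : M.DriverType)
    (hθ : ∀ g : M.Node → ℝ, ∑ i, g (θ' i).node = ∑ i, g (θ i).node + g d.node) :
    ∃ φ, M.IsPotential φ ∧ dualValue θ ρ φ ≤ M.socialWelfare θ ρ ∧
      dualValue θ' ρ φ ≤ M.socialWelfare θ' ρ := by
  have := Fintype.ofFinite (M.Edge R)
  have := Fintype.ofFinite M.Node
  obtain ⟨f, ψ, hc, h0, hf⟩ := exists_compat θ ρ
  -- The extra unit is pushed along arcs that are tight for `φ`, so `φ` is compatible with the flow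
  -- before and after the push.
  obtain ⟨φ, f', h1, h2, h3, h4⟩ := hc.exists_augmentation (exists_edge_to_sink d)
  have h5 : φ none = 0 := h3.trans h0
  refine ⟨φ, isPotential_of_compat h1 h5, dualValue_le_of_compat h1 h5 hf,
    dualValue_le_of_compat h2 h5 fun g hg => ?_⟩
  have h6 : g (M.network ρ).sink = 0 := hg
  rw [h4, hf g hg, hθ, h6, sub_zero]

end Characterization

/-! ### Lattice operations and bounds for single drivers -/

section Lattice

theorem IsPotential.sup {φ ψ : M.Node → ℝ} (hφ : M.IsPotential φ) (hψ : M.IsPotential ψ) :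
    M.IsPotential fun v => max (φ v) (ψ v) where
  sink := by simp [hφ.sink, hψ.sink]
  trip e := by
    rw [← max_add_add_left]
    exact max_le_max (hφ.trip e) (hψ.trip e)
  exit a t := (hφ.exit a t).trans (by gcongr; exact le_max_left _ _)
  enter a t := max_le_max (hφ.enter a t) (hψ.enter a t)
  stay a t := (hφ.stay a t).trans (le_max_left _ _)

theorem IsPotential.inf {φ ψ : M.Node → ℝ} (hφ : M.IsPotential φ) (hψ : M.IsPotential ψ) :
    M.IsPotential fun v => min (φ v) (ψ v) where
  sink := by simp [hφ.sink, hψ.sink]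
  trip e := by
    rw [← min_add_add_left]
    exact min_le_min (hφ.trip e) (hψ.trip e)
  exit a t := by
    rw [← min_add_add_left]
    exact le_min (hφ.exit a t) (hψ.exit a t)
  enter a t := min_le_min (hφ.enter a t) (hψ.enter a t)
  stay a t := le_min (hφ.stay a t) (hψ.stay a t)

/-- The two new differences lie between `a - b` and `a' - b'` and have the same sum, so the
inequality is convexity of the positive part. -/
theorem posPart_submodular (c a b a' b' : ℝ) :
    max 0 (c - (max a a' - max b b')) + max 0 (c - (min a a' - min b b')) ≤
      max 0 (c - (a - b)) + max 0 (c - (a' - b')) := by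
  rcases le_total a a' with h1 | h1 <;> rcases le_total b b' with h2 | h2 <;>
    simp only [h1, h2, max_eq_left, max_eq_right, min_eq_left, min_eq_right] <;>
    grind

variable [Fintype D] [Fintype R]

/-- The driver part is modular because `max + min` is the sum. The rider part is submodular by
`posPart_submodular`. -/
theorem dualValue_submodular (θ : D → M.DriverType) (ρ : R → M.RiderType) (φ ψ : M.Node → ℝ) :
    dualValue θ ρ (fun v => max (φ v) (ψ v)) + dualValue θ ρ (fun v => min (φ v) (ψ v)) ≤
      dualValue θ ρ φ + dualValue θ ρ ψ := by
  have h1 : ∑ i, max (φ (θ i).node) (ψ (θ i).node) + ∑ i, min (φ (θ i).node) (ψ (θ i).node)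
      = ∑ i, φ (θ i).node + ∑ i, ψ (θ i).node := by
    simp only [← Finset.sum_add_distrib, max_add_min]
  have h2 : ∑ j, max 0 ((ρ j).value - tripPrice (fun v => max (φ v) (ψ v)) (ρ j).trip)
      + ∑ j, max 0 ((ρ j).value - tripPrice (fun v => min (φ v) (ψ v)) (ρ j).trip)
      ≤ ∑ j, max 0 ((ρ j).value - tripPrice φ (ρ j).trip)
        + ∑ j, max 0 ((ρ j).value - tripPrice ψ (ρ j).trip) := by
    rw [← Finset.sum_add_distrib, ← Finset.sum_add_distrib]
    refine Finset.sum_le_sum fun j _ => ?_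
    have := posPart_submodular ((ρ j).value - (ρ j).trip.tripCost) (φ (ρ j).trip.origNode)
      (φ (ρ j).trip.destNode) (ψ (ρ j).trip.origNode) (ψ (ρ j).trip.destNode)
    simpa only [tripPrice, add_sub_assoc, sub_sub] using this
  unfold dualValue
  linarith

/-- The dual values at the max and the min are each at least the welfare, and together at most twice
the welfare, so both are optimal. -/
theorem ceUtilities_sup_inf [Finite L] {θ : D → M.DriverType} {ρ : R → M.RiderType}
    {π π' : D → ℝ} (h : π ∈ M.ceUtilities θ ρ) (h' : π' ∈ M.ceUtilities θ ρ) :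
    (fun i => max (π i) (π' i)) ∈ M.ceUtilities θ ρ ∧
      (fun i => min (π i) (π' i)) ∈ M.ceUtilities θ ρ := by
  obtain ⟨φ, hφ, hv, hu⟩ := mem_ceUtilities_iff.1 h
  obtain ⟨ψ, hψ, hv', hu'⟩ := mem_ceUtilities_iff.1 h'
  have h1 := dualValue_submodular θ ρ φ ψ
  have h2 := socialWelfare_le θ ρ (hφ.sup hψ)
  have h3 := socialWelfare_le θ ρ (hφ.inf hψ)
  exact ⟨mem_ceUtilities_iff.2 ⟨_, hφ.sup hψ, by linarith, fun i => by rw [hu, hu']⟩,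
    mem_ceUtilities_iff.2 ⟨_, hφ.inf hψ, by linarith, fun i => by rw [hu, hu']⟩⟩

theorem ceUtilities_nonempty [Finite L] (θ : D → M.DriverType) (ρ : R → M.RiderType) :
    (M.ceUtilities θ ρ).Nonempty := by
  have := Fintype.ofFinite (M.Edge R)
  obtain ⟨f, φ, hc, h0, hf⟩ := exists_compat θ ρ
  obtain ⟨P, hP, -, -⟩ := exists_isCE_of_compat hc h0 hf
  exact ⟨_, P, hP, fun _ => rfl⟩

theorem dualValue_eq_add {D' : Type*} [Fintype D'] {θ : D → M.DriverType}
    {θ' : D' → M.DriverType} {d : M.DriverType} {φ : M.Node → ℝ} (ρ : R → M.RiderType)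
    (hθ : ∑ i, φ (θ' i).node = ∑ i, φ (θ i).node + φ d.node) :
    dualValue θ' ρ φ = dualValue θ ρ φ + φ d.node := by
  unfold dualValue
  rw [hθ]
  ring

theorem sum_node_replica (θ : D → M.DriverType) (d : M.DriverType) (g : M.Node → ℝ) :
    ∑ o : Option D, g ((o.elim d θ : M.DriverType)).node = ∑ i, g (θ i).node + g d.node := by
  rw [Fintype.sum_option, add_comm]
  rfl

theorem sum_node_removal [DecidableEq D] (θ : D → M.DriverType) (i : D) (g : M.Node → ℝ) :
    ∑ i', g (θ i').node = ∑ i' : {i' : D // i' ≠ i}, g (θ i').node + g (θ i).node := by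
  rw [Fintype.sum_eq_add_sum_subtype_ne _ i, add_comm]

variable [Finite L] {θ : D → M.DriverType} {ρ : R → M.RiderType}

/-- An optimal potential remains feasible when the replica joins, so weak duality limits the welfare
gain to `φ` at her node. -/
theorem replicaGain_le {π : D → ℝ} (h : π ∈ M.ceUtilities θ ρ) (i : D) :
    M.replicaGain θ ρ i ≤ π i := by
  obtain ⟨φ, hφ, hv, hu⟩ := mem_ceUtilities_iff.1 h
  have h1 := socialWelfare_le (fun o : Option D => o.elim (θ i) θ) ρ hφ
  rw [dualValue_eq_add ρ (sum_node_replica θ (θ i) φ)] at h1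
  rw [replicaGain, hu]
  linarith

/-- An optimal potential remains feasible for the other drivers, and its dual value for them is
lower by `φ` at the node of `i`. -/
theorem le_removalLoss [DecidableEq D] {π : D → ℝ} (h : π ∈ M.ceUtilities θ ρ) (i : D) :
    π i ≤ M.removalLoss θ ρ i := by
  obtain ⟨φ, hφ, hv, hu⟩ := mem_ceUtilities_iff.1 h
  have h1 := socialWelfare_le (fun i' : {i' : D // i' ≠ i} => θ i') ρ hφ
  rw [dualValue_eq_add ρ (sum_node_removal θ i φ)] at hv
  rw [removalLoss, hu]
  linarith

/-- For a potential optimal with and without the replica, the two dual values differ by exactly `φ`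
at her node. -/
theorem exists_ceUtilities_le_replicaGain (θ : D → M.DriverType) (ρ : R → M.RiderType) (i : D) :
    ∃ π ∈ M.ceUtilities θ ρ, π i ≤ M.replicaGain θ ρ i := by
  obtain ⟨φ, hφ, h1, h2⟩ := exists_common_potential θ ρ (fun o : Option D => o.elim (θ i) θ) (θ i)
    (sum_node_replica θ (θ i))
  refine ⟨_, mem_ceUtilities_iff.2 ⟨φ, hφ, h1, fun _ => rfl⟩, ?_⟩
  have h3 := socialWelfare_le θ ρ hφ
  rw [dualValue_eq_add ρ (sum_node_replica θ (θ i) φ)] at h2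
  rw [replicaGain]
  linarith

/-- As for the replica, but the smaller market now consists of the drivers other than `i`, and the
augmentation adds `i` back. -/
theorem exists_removalLoss_le_ceUtilities [DecidableEq D] (θ : D → M.DriverType)
    (ρ : R → M.RiderType) (i : D) :
    ∃ π ∈ M.ceUtilities θ ρ, M.removalLoss θ ρ i ≤ π i := by
  obtain ⟨φ, hφ, h1, h2⟩ := exists_common_potential (fun i' : {i' : D // i' ≠ i} => θ i') ρ θ (θ i)
    (sum_node_removal θ i)
  refine ⟨_, mem_ceUtilities_iff.2 ⟨φ, hφ, h2, fun _ => rfl⟩, ?_⟩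
  have h3 := socialWelfare_le θ ρ hφ
  rw [dualValue_eq_add ρ (sum_node_removal θ i φ)] at h3
  rw [removalLoss]
  linarith

end Lattice

/-! ### Least and greatest profiles -/

section Extremes

variable [Finite L] [Fintype D] [Fintype R]

theorem isLeast_replicaGain (θ : D → M.DriverType) (ρ : R → M.RiderType) :
    IsLeast (M.ceUtilities θ ρ) (M.replicaGain θ ρ) := by
  classical
  refine ⟨?_, fun π h i => replicaGain_le h i⟩
  -- Each driver has her own profile attaining her bound. Componentwise minima merge these over
  -- finite sets of drivers.
  have key : ∀ s : Finset D, ∃ π ∈ M.ceUtilities θ ρ, ∀ i ∈ s, π i ≤ M.replicaGain θ ρ i := by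
    intro s
    induction s using Finset.induction_on with
    | empty =>
      obtain ⟨π, h⟩ := ceUtilities_nonempty θ ρ
      exact ⟨π, h, by simp⟩
    | insert a s _ ih =>
      obtain ⟨π, h, hs⟩ := ih
      obtain ⟨π', h', ha⟩ := exists_ceUtilities_le_replicaGain θ ρ a
      refine ⟨_, (ceUtilities_sup_inf h h').2, fun i hi => ?_⟩
      rcases Finset.mem_insert.1 hi with rfl | hi
      · exact (min_le_right _ _).trans ha
      · exact (min_le_left _ _).trans (hs i hi)
  obtain ⟨π, h, hle⟩ := key Finset.univ
  have : M.replicaGain θ ρ = π := funext fun i =>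
    le_antisymm (replicaGain_le h i) (hle i (Finset.mem_univ i))
  rwa [this]

theorem isGreatest_removalLoss [DecidableEq D] (θ : D → M.DriverType) (ρ : R → M.RiderType) :
    IsGreatest (M.ceUtilities θ ρ) (M.removalLoss θ ρ) := by
  refine ⟨?_, fun π h i => le_removalLoss h i⟩
  -- The dual argument, merging with componentwise maxima.
  have key : ∀ s : Finset D, ∃ π ∈ M.ceUtilities θ ρ, ∀ i ∈ s, M.removalLoss θ ρ i ≤ π i := by
    intro s
    induction s using Finset.induction_on with
    | empty =>
      obtain ⟨π, h⟩ := ceUtilities_nonempty θ ρ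
      exact ⟨π, h, by simp⟩
    | insert a s _ ih =>
      obtain ⟨π, h, hs⟩ := ih
      obtain ⟨π', h', ha⟩ := exists_removalLoss_le_ceUtilities θ ρ a
      refine ⟨_, (ceUtilities_sup_inf h h').1, fun i hi => ?_⟩
      rcases Finset.mem_insert.1 hi with rfl | hi
      · exact ha.trans (le_max_right _ _)
      · exact (hs i hi).trans (le_max_left _ _)
  obtain ⟨π, h, hle⟩ := key Finset.univ
  have : M.removalLoss θ ρ = π := funext fun i =>
    le_antisymm (hle i (Finset.mem_univ i)) (le_removalLoss h i)
  rwa [this]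

end Extremes

end Market

theorem lemma4 {L D R : Type*} [Finite L] [Fintype D] [DecidableEq D] [Fintype R]
    (M : Market L) (θ : D → M.DriverType) (ρ : R → M.RiderType) :
    (∀ π ∈ M.ceUtilities θ ρ, ∀ π' ∈ M.ceUtilities θ ρ,
      (fun i => max (π i) (π' i)) ∈ M.ceUtilities θ ρ ∧
      (fun i => min (π i) (π' i)) ∈ M.ceUtilities θ ρ) ∧
    IsLeast (M.ceUtilities θ ρ) (M.replicaGain θ ρ) ∧
    IsGreatest (M.ceUtilities θ ρ) (M.removalLoss θ ρ) :=
  ⟨fun _ h _ h' => Market.ceUtilities_sup_inf h h', Market.isLeast_replicaGain θ ρ,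
    Market.isGreatest_removalLoss θ ρ⟩
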